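/- **Theorem.** Let $\mathcal{G}=(A,\Delta)$ be a compact quantum group, i.e. a nonzero unital $C^*$-algebra $A$ with a unital $*$-homomorphism $\Delta\colon A\to A\otimes A$ (minimal tensor product) such that $(\Delta\otimes \mathrm{id})\Delta=(\mathrm{id}\otimes\Delta)\Delta$ and the linear spans of $\Delta(A)(1\otimes A)$ and $\Delta(A)(A\otimes 1)$ are dense in $A\otimes A$. Let $\alpha$ be an action of $\mathcal{G}$ on a unital $C^*$-algebra $B$, i.e. a unital $*$-homomorphism $\alpha\colon B\to B\otimes A$ such that $(\alpha\otimes\mathrm{id})\alpha=(\mathrm{id}\otimes\Delta)\alpha$ and the linear span of $\alpha(B)(1\otimes A)$ is dense in $B\otimes A$. Let $\mu$ be an $\alpha$-invariant state on $B$, i.e. a state with $(\mu\otimes\mathrm{id})\alpha(b)=\mu(b)1_A$ for all $b\in B$. Let $I_\mu$ be the kernel of the GNS representation of $B$ with respect to $\mu$, and let $\pi_\mu\colon B\to B/I_\mu$ be the quotient map. Then the closed two-sided ideal $I_\mu$ is $\alpha$-invariant, i.e. $(\pi_\mu\otimes\mathrm{id})\alpha(b)=0$ for all $b\in I_\mu$.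 Moreover, the induced map $\alpha_\mu\colon B/I_\mu\to (B/I_\mu)\otimes A$, $\alpha_\mu(b+I_\mu)=(\pi_\mu\otimes\mathrm{id})\alpha(b)$, is an action of $\mathcal{G}$ on $B/I_\mu$, and it is injective. -/

import Mathlib

open scoped TensorProduct ENNReal InnerProductSpace ComplexOrder

noncomputable section

namespace QuantumAction

universe u v

/-- A state of a unital C*-algebra: a positive linear functional with value `1` at `1`. -/
structure State (A : Type u) [CStarAlgebra A] where
  toLinearMap : A →ₗ[ℂ] ℂ
  nonneg : ∀ a : A, 0 ≤ toLinearMap (star a * a)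
  map_one : toLinearMap 1 = 1

namespace State

variable {A : Type u} [CStarAlgebra A]

instance : CoeFun (State A) (fun _ => A → ℂ) := ⟨fun φ => φ.toLinearMap⟩

/-- A state as a positive linear functional for the canonical order of the C*-algebra. -/
def toPositive (φ : State A) :
    letI := CStarAlgebra.spectralOrder A
    A →ₚ[ℂ] ℂ :=
  letI := CStarAlgebra.spectralOrder A
  letI := CStarAlgebra.spectralOrderedRing A
  PositiveLinearMap.mk₀ φ.toLinearMap (fun x hx => by
    obtain ⟨b, rfl⟩ := CStarAlgebra.nonneg_iff_eq_star_mul_self.mp hx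
    exact φ.nonneg b)

/-- The GNS Hilbert space of a state. -/
def GNSSpace (φ : State A) : Type u :=
  letI := CStarAlgebra.spectralOrder A
  letI := CStarAlgebra.spectralOrderedRing A
  φ.toPositive.GNS

instance (φ : State A) : NormedAddCommGroup φ.GNSSpace :=
  letI := CStarAlgebra.spectralOrder A
  letI := CStarAlgebra.spectralOrderedRing A
  inferInstanceAs (NormedAddCommGroup φ.toPositive.GNS)

instance (φ : State A) : InnerProductSpace ℂ φ.GNSSpace :=
  letI := CStarAlgebra.spectralOrder A
  letI := CStarAlgebra.spectralOrderedRing A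
  inferInstanceAs (InnerProductSpace ℂ φ.toPositive.GNS)

instance (φ : State A) : CompleteSpace φ.GNSSpace :=
  letI := CStarAlgebra.spectralOrder A
  letI := CStarAlgebra.spectralOrderedRing A
  inferInstanceAs (CompleteSpace φ.toPositive.GNS)

/-- The GNS representation of a state. -/
def gns (φ : State A) : A →⋆ₐ[ℂ] (φ.GNSSpace →L[ℂ] φ.GNSSpace) :=
  letI := CStarAlgebra.spectralOrder A
  letI := CStarAlgebra.spectralOrderedRing A
  φ.toPositive.gnsStarAlgHom

/-- The cyclic vector of the GNS representation. -/
def cyclic (φ : State A) : φ.GNSSpace :=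
  letI := CStarAlgebra.spectralOrder A
  letI := CStarAlgebra.spectralOrderedRing A
  ((φ.toPositive.toPreGNS 1 : φ.toPositive.PreGNS) : φ.toPositive.GNS)

theorem inner_cyclic (φ : State A) (a : A) : ⟪φ.cyclic, φ.gns a φ.cyclic⟫_ℂ = φ a := by
  let _ := CStarAlgebra.spectralOrder A
  let _ := CStarAlgebra.spectralOrderedRing A
  have h1 : φ.gns a φ.cyclic =
    ((φ.toPositive.toPreGNS a : φ.toPositive.PreGNS) : φ.toPositive.GNS) := by
    change φ.toPositive.gnsNonUnitalStarAlgHom a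
      ((φ.toPositive.toPreGNS 1 : φ.toPositive.PreGNS) : φ.toPositive.GNS) = _
    rw [PositiveLinearMap.gnsNonUnitalStarAlgHom_apply_coe]
    simp
  rw [h1]
  change ⟪((φ.toPositive.toPreGNS 1 : φ.toPositive.PreGNS) : φ.toPositive.GNS),
    ((φ.toPositive.toPreGNS a : φ.toPositive.PreGNS) : φ.toPositive.GNS)⟫_ℂ = _
  rw [UniformSpace.Completion.inner_coe, PositiveLinearMap.preGNS_inner_def]
  simp only [PositiveLinearMap.ofPreGNS_toPreGNS, star_one, one_mul]
  rfl

theorem norm_cyclic (φ : State A) : ‖φ.cyclic‖ = 1 := by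
  have h := φ.inner_cyclic 1
  rw [_root_.map_one, φ.map_one, one_apply_eq_self, inner_self_eq_norm_sq_to_K] at h
  have h' : ‖φ.cyclic‖ ^ 2 = 1 := Complex.ofReal_injective (by simpa using h)
  nlinarith [norm_nonneg φ.cyclic]

instance (φ : State A) : Nontrivial φ.GNSSpace :=
  ⟨φ.cyclic, 0, fun h => by simpa [h] using φ.norm_cyclic⟩

end State

/-- The Hilbert space tensor product. -/
def HTensor (H : Type u) (K : Type v) [NormedAddCommGroup H] [InnerProductSpace ℂ H]
    [NormedAddCommGroup K] [InnerProductSpace ℂ K] : Type (max u v) :=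
  UniformSpace.Completion (H ⊗[ℂ] K)

section HilbertTensor

variable {H : Type*} {K : Type*} {H' : Type*} {K' : Type*}
  [NormedAddCommGroup H] [InnerProductSpace ℂ H]
  [NormedAddCommGroup K] [InnerProductSpace ℂ K]

instance : NormedAddCommGroup (HTensor H K) :=
  inferInstanceAs (NormedAddCommGroup (UniformSpace.Completion (H ⊗[ℂ] K)))

instance : InnerProductSpace ℂ (HTensor H K) :=
  inferInstanceAs (InnerProductSpace ℂ (UniformSpace.Completion (H ⊗[ℂ] K)))

instance : CompleteSpace (HTensor H K) :=
  inferInstanceAs (CompleteSpace (UniformSpace.Completion (H ⊗[ℂ] K)))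

variable
  [NormedAddCommGroup H'] [InnerProductSpace ℂ H']
  [NormedAddCommGroup K'] [InnerProductSpace ℂ K']

/-- The canonical isometry from the algebraic tensor product into its completion. -/
def hincl : (H ⊗[ℂ] K) →ₗᵢ[ℂ] HTensor H K :=
  (UniformSpace.Completion.toComplₗᵢ : (H ⊗[ℂ] K) →ₗᵢ[ℂ] UniformSpace.Completion (H ⊗[ℂ] K))

theorem hincl_dense : DenseRange (hincl : (H ⊗[ℂ] K) →ₗᵢ[ℂ] HTensor H K) :=
  UniformSpace.Completion.denseRange_coe

/-- The elementary tensor `ξ ⊗ η` in the Hilbert space tensor product. -/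
def htmul (ξ : H) (η : K) : HTensor H K := hincl (ξ ⊗ₜ[ℂ] η)

theorem inner_htmul (ξ ξ' : H) (η η' : K) :
    ⟪htmul ξ η, htmul ξ' η'⟫_ℂ = ⟪ξ, ξ'⟫_ℂ * ⟪η, η'⟫_ℂ := by
  simp [htmul, LinearIsometry.inner_map_map]

theorem norm_htmul (ξ : H) (η : K) : ‖htmul ξ η‖ = ‖ξ‖ * ‖η‖ := by
  simp [htmul]

theorem span_htmul_dense :
    Dense (Submodule.span ℂ {ζ : HTensor H K | ∃ ξ η, ζ = htmul ξ η} : Set (HTensor H K)) := by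
  refine hincl_dense.mono ?_
  rintro _ ⟨z, rfl⟩
  induction z with
  | zero => rw [map_zero]; exact Submodule.zero_mem _
  | tmul x y => exact Submodule.subset_span ⟨x, y, rfl⟩
  | add x y hx hy => rw [map_add]; exact Submodule.add_mem _ hx hy

/-- The bounded operator `S ⊗ T` between Hilbert space tensor products. -/
def opTensor (S : H →L[ℂ] H') (T : K →L[ℂ] K') : HTensor H K →L[ℂ] HTensor H' K' :=
  ((TensorProduct.mapL S T).completion :
    UniformSpace.Completion (H ⊗[ℂ] K) →L[ℂ] UniformSpace.Completion (H' ⊗[ℂ] K'))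

@[simp] theorem opTensor_hincl (S : H →L[ℂ] H') (T : K →L[ℂ] K') (x : H ⊗[ℂ] K) :
    opTensor S T (hincl x) = hincl (TensorProduct.mapL S T x) :=
  ContinuousLinearMap.completion_apply_coe _ _

@[simp] theorem opTensor_htmul (S : H →L[ℂ] H') (T : K →L[ℂ] K') (ξ : H) (η : K) :
    opTensor S T (htmul ξ η) = htmul (S ξ) (T η) := by
  simp [htmul]

theorem ext_htmul {E : Type*} [NormedAddCommGroup E] [NormedSpace ℂ E]
    {S T : HTensor H K →L[ℂ] E} (h : ∀ ξ η, S (htmul ξ η) = T (htmul ξ η)) : S = T := by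
  refine ContinuousLinearMap.ext_on span_htmul_dense ?_
  rintro _ ⟨ξ, η, rfl⟩
  exact h ξ η

theorem norm_opTensor_le (S : H →L[ℂ] H') (T : K →L[ℂ] K') :
    ‖opTensor S T‖ ≤ ‖S‖ * ‖T‖ := by
  refine ContinuousLinearMap.opNorm_le_bound _ (by positivity) fun x => ?_
  refine hincl_dense.induction_on (p := fun x => ‖opTensor S T x‖ ≤ ‖S‖ * ‖T‖ * ‖x‖) x
    (isClosed_le (by fun_prop) (by fun_prop)) fun x => ?_
  rw [opTensor_hincl, LinearIsometry.norm_map, LinearIsometry.norm_map]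
  exact (ContinuousLinearMap.le_opNorm _ _).trans
    (mul_le_mul_of_nonneg_right (TensorProduct.norm_mapL_le S T) (norm_nonneg _))

theorem htmul_add_left (ξ ξ' : H) (η : K) : htmul (ξ + ξ') η = htmul ξ η + htmul ξ' η := by
  simp [htmul, TensorProduct.add_tmul]

theorem htmul_add_right (ξ : H) (η η' : K) : htmul ξ (η + η') = htmul ξ η + htmul ξ η' := by
  simp [htmul, TensorProduct.tmul_add]

theorem htmul_smul_left (c : ℂ) (ξ : H) (η : K) : htmul (c • ξ) η = c • htmul ξ η := by
  simp [htmul, ← TensorProduct.smul_tmul']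

theorem htmul_smul_right (c : ℂ) (ξ : H) (η : K) : htmul ξ (c • η) = c • htmul ξ η := by
  simp [htmul]

theorem star_opTensor [CompleteSpace H] [CompleteSpace K] (S : H →L[ℂ] H) (T : K →L[ℂ] K) :
    star (opTensor S T) = opTensor (star S) (star T) := by
  rw [ContinuousLinearMap.star_eq_adjoint, eq_comm, ContinuousLinearMap.eq_adjoint_iff]
  intro x y
  have key : ∀ ξ η, innerSL ℂ (opTensor (star S) (star T) (htmul ξ η)) =
      (innerSL ℂ (htmul ξ η)).comp (opTensor S T) := fun ξ η => ext_htmul fun ξ' η' => by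
    simp [inner_htmul, ContinuousLinearMap.star_eq_adjoint, ContinuousLinearMap.adjoint_inner_left]
  have h2 : (innerSL ℂ y).comp (opTensor (star S) (star T)) =
      innerSL ℂ ((opTensor S T) y) := ext_htmul fun ξ η => by
    have := congrArg (fun f => f y) (key ξ η)
    simp only [innerSL_apply_apply, ContinuousLinearMap.comp_apply] at this
    rw [ContinuousLinearMap.comp_apply, innerSL_apply_apply, innerSL_apply_apply,
      ← inner_conj_symm, this, inner_conj_symm]
  have h3 := congrArg (fun f => f x) h2
  simp only [innerSL_apply_apply, ContinuousLinearMap.comp_apply] at h3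
  rw [← inner_conj_symm, h3, inner_conj_symm]

instance [Nontrivial H] [Nontrivial K] : Nontrivial (HTensor H K) := by
  obtain ⟨ξ, hξ⟩ := exists_ne (0 : H)
  obtain ⟨η, hη⟩ := exists_ne (0 : K)
  refine ⟨htmul ξ η, 0, fun h => ?_⟩
  have := norm_htmul ξ η
  rw [h, norm_zero] at this
  exact mul_ne_zero (norm_ne_zero_iff.mpr hξ) (norm_ne_zero_iff.mpr hη) this.symm

/-- The operators `S ⊗ 1`, as an algebra homomorphism. -/
def ampLeft : (H →L[ℂ] H) →ₐ[ℂ] (HTensor H K →L[ℂ] HTensor H K) :=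
  AlgHom.ofLinearMap
    { toFun := fun S => opTensor S 1
      map_add' := fun S T => ext_htmul fun ξ η => by simp [htmul_add_left]
      map_smul' := fun c S => ext_htmul fun ξ η => by simp [htmul_smul_left] }
    (ext_htmul fun ξ η => by simp)
    (fun S T => ext_htmul fun ξ η => by simp)

/-- The operators `1 ⊗ T`, as an algebra homomorphism. -/
def ampRight : (K →L[ℂ] K) →ₐ[ℂ] (HTensor H K →L[ℂ] HTensor H K) :=
  AlgHom.ofLinearMap
    { toFun := fun T => opTensor 1 T
      map_add' := fun S T => ext_htmul fun ξ η => by simp [htmul_add_right]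
      map_smul' := fun c S => ext_htmul fun ξ η => by simp [htmul_smul_right] }
    (ext_htmul fun ξ η => by simp)
    (fun S T => ext_htmul fun ξ η => by simp)

theorem amp_commute (S : H →L[ℂ] H) (T : K →L[ℂ] K) :
    Commute (ampLeft (K := K) S) (ampRight (H := H) T) :=
  ext_htmul fun ξ η => by simp [ampLeft, ampRight]

end HilbertTensor

section AlgRep

variable {A : Type*} {B : Type*} [CStarAlgebra A] [CStarAlgebra B]
  {H : Type*} {K : Type*}
  [NormedAddCommGroup H] [InnerProductSpace ℂ H] [CompleteSpace H]
  [NormedAddCommGroup K] [InnerProductSpace ℂ K] [CompleteSpace K]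

/-- The representation `π ⊙ ρ` of the algebraic tensor product, `a ⊗ b ↦ π a ⊗ ρ b`, as an algebra
homomorphism. -/
def algRepAux (π : A →⋆ₐ[ℂ] (H →L[ℂ] H)) (ρ : B →⋆ₐ[ℂ] (K →L[ℂ] K)) :
    A ⊗[ℂ] B →ₐ[ℂ] (HTensor H K →L[ℂ] HTensor H K) :=
  Algebra.TensorProduct.lift ((ampLeft (K := K)).comp π.toAlgHom)
      ((ampRight (H := H)).comp ρ.toAlgHom)
      (by intro a b; exact amp_commute (π a) (ρ b))

@[simp] theorem algRepAux_tmul (π : A →⋆ₐ[ℂ] (H →L[ℂ] H)) (ρ : B →⋆ₐ[ℂ] (K →L[ℂ] K))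
    (a : A) (b : B) : algRepAux π ρ (a ⊗ₜ b) = opTensor (π a) (ρ b) := by
  refine (Algebra.TensorProduct.lift_tmul _ _ _ a b).trans ?_
  exact ext_htmul fun ξ η => by simp [ampLeft, ampRight]

/-- The representation `π ⊙ ρ` of the algebraic tensor product, `a ⊗ b ↦ π a ⊗ ρ b`. -/
def algRep (π : A →⋆ₐ[ℂ] (H →L[ℂ] H)) (ρ : B →⋆ₐ[ℂ] (K →L[ℂ] K)) :
    A ⊗[ℂ] B →⋆ₐ[ℂ] (HTensor H K →L[ℂ] HTensor H K) :=
  { algRepAux π ρ with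
    map_star' := fun x => by
      change algRepAux π ρ (star x) = star (algRepAux π ρ x)
      induction x with
      | zero => simp
      | add x y hx hy => simp only [star_add, map_add, hx, hy]
      | tmul a b => simp [star_opTensor, map_star] }

@[simp] theorem algRep_tmul (π : A →⋆ₐ[ℂ] (H →L[ℂ] H)) (ρ : B →⋆ₐ[ℂ] (K →L[ℂ] K)) (a : A) (b : B) :
    algRep π ρ (a ⊗ₜ b) = opTensor (π a) (ρ b) :=
  algRepAux_tmul π ρ a b

/-- An upper bound for `‖(π ⊙ ρ) x‖` that is uniform in the representations. -/
theorem exists_norm_algRep_le (x : A ⊗[ℂ] B) : ∃ C : ℝ, ∀ (φ : State A) (ψ : State B),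
    ‖algRep φ.gns ψ.gns x‖ ≤ C := by
  induction x with
  | zero => exact ⟨0, fun φ ψ => by simp⟩
  | add x y hx hy =>
    obtain ⟨C, hC⟩ := hx
    obtain ⟨D, hD⟩ := hy
    refine ⟨C + D, fun φ ψ => ?_⟩
    rw [map_add]
    exact (norm_add_le _ _).trans (add_le_add (hC φ ψ) (hD φ ψ))
  | tmul a b =>
    refine ⟨‖a‖ * ‖b‖, fun φ ψ => ?_⟩
    rw [algRep_tmul]
    refine (norm_opTensor_le _ _).trans ?_
    gcongr <;> exact NonUnitalStarAlgHom.norm_apply_le _ _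

end AlgRep

/-- The C*-algebra of bounded operators on the Hilbert space `H_φ ⊗ H_ψ` belonging to a
pair of states. -/
def RepAlg {A : Type u} {B : Type v} [CStarAlgebra A] [CStarAlgebra B]
    (p : State A × State B) : Type (max u v) :=
  HTensor p.1.GNSSpace p.2.GNSSpace →L[ℂ] HTensor p.1.GNSSpace p.2.GNSSpace

section MinTensor

variable {A : Type u} {B : Type v} [CStarAlgebra A] [CStarAlgebra B]

instance (p : State A × State B) : CStarAlgebra (RepAlg p) :=
  inferInstanceAs (CStarAlgebra
    (HTensor p.1.GNSSpace p.2.GNSSpace →L[ℂ] HTensor p.1.GNSSpace p.2.GNSSpace))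

instance (p : State A × State B) : Nontrivial (RepAlg p) :=
  inferInstanceAs (Nontrivial
    (HTensor p.1.GNSSpace p.2.GNSSpace →L[ℂ] HTensor p.1.GNSSpace p.2.GNSSpace))

/-- The representation `π_φ ⊙ π_ψ`. -/
def stateRep (p : State A × State B) : A ⊗[ℂ] B →⋆ₐ[ℂ] RepAlg p := algRep p.1.gns p.2.gns

/-- The ℓ^∞ direct sum of the C*-algebras `B(H_φ ⊗ H_ψ)` over all pairs of states. -/
abbrev RepSum (A : Type u) (B : Type v) [CStarAlgebra A] [CStarAlgebra B] : Type (max u v) :=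
  lp (fun p : State A × State B => RepAlg p) ∞

instance : CStarAlgebra (RepSum A B) where

theorem memℓp_stateRep (x : A ⊗[ℂ] B) : Memℓp (fun p : State A × State B => stateRep p x) ∞ :=
  memℓp_infty (by
    obtain ⟨C, hC⟩ := exists_norm_algRep_le x
    exact ⟨C, by rintro _ ⟨p, rfl⟩; exact hC p.1 p.2⟩)

/-- The direct sum of the representations `π_φ ⊙ π_ψ` over all states `φ` of `A` and `ψ` of `B`. -/
def sumRep (A : Type u) (B : Type v) [CStarAlgebra A] [CStarAlgebra B] :
    A ⊗[ℂ] B →⋆ₐ[ℂ] RepSum A B where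
  toFun x := ⟨fun p => stateRep p x, memℓp_stateRep x⟩
  map_one' := lp.ext (funext fun p => map_one (stateRep p))
  map_mul' x y := lp.ext (funext fun p => map_mul (stateRep p) x y)
  map_zero' := lp.ext (funext fun p => map_zero (stateRep p))
  map_add' x y := lp.ext (funext fun p => map_add (stateRep p) x y)
  commutes' c := lp.ext (funext fun p => AlgHomClass.commutes (stateRep p) c)
  map_star' x := lp.ext (funext fun p => map_star (stateRep p) x)

/-- The minimal (spatial) tensor product of two unital C*-algebras: the closure of the image of the
algebraic tensor product, that is, its completion for the norm
`‖x‖ = sup ‖(π_φ ⊗ π_ψ) x‖` over the GNS representations of all states. -/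
def MinTensor (A : Type u) (B : Type v) [CStarAlgebra A] [CStarAlgebra B] : Type (max u v) :=
  (sumRep A B).range.topologicalClosure

instance : CStarAlgebra (MinTensor A B) :=
  have : IsClosed ((sumRep A B).range.topologicalClosure : Set (RepSum A B)) :=
    StarSubalgebra.isClosed_topologicalClosure _
  inferInstanceAs (CStarAlgebra (sumRep A B).range.topologicalClosure)

/-- The canonical map from the algebraic to the minimal tensor product. -/
def incl (A : Type u) (B : Type v) [CStarAlgebra A] [CStarAlgebra B] :
    A ⊗[ℂ] B →⋆ₐ[ℂ] MinTensor A B :=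
  (StarSubalgebra.inclusion (StarSubalgebra.le_topologicalClosure (sumRep A B).range)).comp
    (sumRep A B).rangeRestrict

theorem incl_dense : DenseRange (incl A B) := by
  refine Subtype.dense_iff.mpr fun {x} hx => ?_
  refine closure_mono ?_ hx
  rintro _ ⟨y, rfl⟩
  exact ⟨incl A B y, ⟨y, rfl⟩, rfl⟩

theorem norm_incl (x : A ⊗[ℂ] B) :
    ‖incl A B x‖ = ⨆ p : State A × State B, ‖algRep p.1.gns p.2.gns x‖ :=
  lp.norm_eq_ciSup (sumRep A B x)

theorem norm_algRep_gns_le (x : A ⊗[ℂ] B) (φ : State A) (ψ : State B) :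
    ‖algRep φ.gns ψ.gns x‖ ≤ ‖incl A B x‖ :=
  lp.norm_apply_le_norm ENNReal.top_ne_zero (sumRep A B x) (φ, ψ)

theorem norm_incl_le (x : A ⊗[ℂ] B) {C : ℝ} (hC : 0 ≤ C)
    (h : ∀ (φ : State A) (ψ : State B), ‖algRep φ.gns ψ.gns x‖ ≤ C) : ‖incl A B x‖ ≤ C :=
  lp.norm_le_of_forall_le hC (f := sumRep A B x) fun p => h p.1 p.2

/-- The elementary tensor `a ⊗ b` in the minimal tensor product. -/
def mtmul (a : A) (b : B) : MinTensor A B := incl A B (a ⊗ₜ b)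

end MinTensor

section Extend

variable {X Y Z : Type*} [Ring X] [Algebra ℂ X] [StarRing X]
  [CStarAlgebra Y] [CStarAlgebra Z]

/-- Continuous extension of a `*`-homomorphism `f` along a `*`-homomorphism `e` with dense range that
dominates it in norm. -/
def extendHom (e : X →⋆ₐ[ℂ] Y) (f : X →⋆ₐ[ℂ] Z) (he : DenseRange e)
    (h : ∀ x, ‖f x‖ ≤ ‖e x‖) : Y →⋆ₐ[ℂ] Z :=
  let F : Y →L[ℂ] Z :=
    LinearMap.extendOfNorm (f.toAlgHom.toLinearMap) (e.toAlgHom.toLinearMap)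
  have hF : ∀ x, F (e x) = f x := fun x =>
    LinearMap.extendOfNorm_eq (f := f.toAlgHom.toLinearMap) (e := e.toAlgHom.toLinearMap)
      he ⟨1, fun x => by simpa using h x⟩ x
  { toFun := F
    map_one' := by simpa using hF 1
    map_zero' := map_zero F
    map_add' := map_add F
    map_mul' := fun x y => he.induction_on₂ (p := fun x y => F (x * y) = F x * F y)
      (isClosed_eq (by fun_prop) (by fun_prop))
      (fun a b => by rw [← map_mul, hF, hF, hF, map_mul]) x y
    commutes' := fun c => (congrArg F (AlgHomClass.commutes e c)).symm.trans
      ((hF _).trans (AlgHomClass.commutes f c))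
    map_star' := fun x => he.induction_on (p := fun x => F (star x) = star (F x)) x
      (isClosed_eq (by fun_prop) (by fun_prop))
      (fun a => by rw [← map_star, hF, hF, map_star]) }

theorem extendHom_apply (e : X →⋆ₐ[ℂ] Y) (f : X →⋆ₐ[ℂ] Z) (he : DenseRange e)
    (h : ∀ x, ‖f x‖ ≤ ‖e x‖) (x : X) : extendHom e f he h (e x) = f x :=
  LinearMap.extendOfNorm_eq (f := f.toAlgHom.toLinearMap) (e := e.toAlgHom.toLinearMap)
      he ⟨1, fun x => by simpa using h x⟩ x

end Extend

section Growth

variable {L : Type*} [NormedAddCommGroup L] [InnerProductSpace ℂ L] [CompleteSpace L]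

theorem norm_apply_le_of_growth {T : L →L[ℂ] L} (hT : star T = T) {R c : ℝ} (hR : 0 ≤ R) (ζ : L)
    (h : ∀ n : ℕ, ‖(T ^ n) ζ‖ ≤ c * R ^ n) : ‖T ζ‖ ≤ R * ‖ζ‖ := by
  by_contra! hlt
  have hconv : ∀ n : ℕ, ‖(T ^ (n + 1)) ζ‖ ^ 2 ≤ ‖(T ^ n) ζ‖ * ‖(T ^ (n + 2)) ζ‖ := fun n => by
    have hadj : ContinuousLinearMap.adjoint T = T := hT
    have e1 : (T ^ (n + 1)) ζ = T ((T ^ n) ζ) := by rw [pow_succ']; rfl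
    have e2 : (T ^ (n + 2)) ζ = T ((T ^ (n + 1)) ζ) := by rw [pow_succ']; rfl
    have : ((‖(T ^ (n + 1)) ζ‖ ^ 2 : ℝ) : ℂ) = ⟪(T ^ n) ζ, (T ^ (n + 2)) ζ⟫_ℂ := by
      rw [e2, ← ContinuousLinearMap.adjoint_inner_left, hadj, ← e1, inner_self_eq_norm_sq_to_K]
      simp
    have h2 := norm_inner_le_norm (𝕜 := ℂ) ((T ^ n) ζ) ((T ^ (n + 2)) ζ)
    rw [← this, Complex.norm_real, Real.norm_of_nonneg (by positivity)] at h2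
    exact h2
  have hζ : 0 < ‖ζ‖ := by
    rw [norm_pos_iff]
    rintro rfl
    simp at hlt
  set r := ‖T ζ‖ / ‖ζ‖ with hr
  have hrR : R < r := by rwa [hr, lt_div_iff₀ hζ]
  have hr0 : 0 < r := hR.trans_lt hrR
  have hgrow : ∀ n : ℕ, 0 < ‖(T ^ n) ζ‖ ∧ r * ‖(T ^ n) ζ‖ ≤ ‖(T ^ (n + 1)) ζ‖ := by
    intro n
    induction n with
    | zero => simp [hζ, hr, div_mul_cancel₀ _ hζ.ne']
    | succ n ih =>
      obtain ⟨h0, h1⟩ := ih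
      have hp : 0 < ‖(T ^ (n + 1)) ζ‖ := lt_of_lt_of_le (by positivity) h1
      refine ⟨hp, ?_⟩
      have := hconv n
      by_contra! hcon
      have : ‖(T ^ (n + 1)) ζ‖ ^ 2 < ‖(T ^ n) ζ‖ * (r * ‖(T ^ (n + 1)) ζ‖) :=
        this.trans_lt (mul_lt_mul_of_pos_left hcon h0)
      nlinarith
  have hlow : ∀ n : ℕ, r ^ n * ‖ζ‖ ≤ ‖(T ^ n) ζ‖ := by
    intro n
    induction n with
    | zero => simp
    | succ n ih =>
      calc r ^ (n + 1) * ‖ζ‖ = r * (r ^ n * ‖ζ‖) := by ring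
        _ ≤ r * ‖(T ^ n) ζ‖ := by gcongr
        _ ≤ _ := (hgrow n).2
  have hlim : Filter.Tendsto (fun n : ℕ => c * (R / r) ^ n) Filter.atTop (nhds (c * 0)) :=
    (tendsto_pow_atTop_nhds_zero_of_lt_one (by positivity) ((div_lt_one hr0).mpr hrR)).const_mul c
  have hle : ‖ζ‖ ≤ c * 0 := ge_of_tendsto' hlim fun n => by
    have := (hlow n).trans (h n)
    rw [div_pow, mul_div_assoc', le_div_iff₀ (by positivity)]
    linarith
  linarith

/-- A selfadjoint operator whose powers grow at most like `R ^ n` on a total set of vectors has norm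
at most `R`. -/
theorem norm_le_of_growth {T : L →L[ℂ] L} (hT : star T = T) {R : ℝ} (hR : 0 ≤ R) (S : Set L)
    (hS : Dense (Submodule.span ℂ S : Set L))
    (h : ∀ ζ ∈ S, ∃ c : ℝ, ∀ n : ℕ, ‖(T ^ n) ζ‖ ≤ c * R ^ n) : ‖T‖ ≤ R := by
  have h' : ∀ ζ ∈ Submodule.span ℂ S, ∃ c : ℝ, ∀ n : ℕ, ‖(T ^ n) ζ‖ ≤ c * R ^ n := by
    intro ζ hζ
    induction hζ using Submodule.span_induction with
    | mem x hx => exact h x hx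
    | zero => exact ⟨0, by simp⟩
    | add x y _ _ hx hy =>
      obtain ⟨c, hc⟩ := hx
      obtain ⟨d, hd⟩ := hy
      refine ⟨c + d, fun n => ?_⟩
      rw [map_add, add_mul]
      exact (norm_add_le _ _).trans (add_le_add (hc n) (hd n))
    | smul a x _ hx =>
      obtain ⟨c, hc⟩ := hx
      refine ⟨‖a‖ * c, fun n => ?_⟩
      rw [map_smul, norm_smul, mul_assoc]
      exact mul_le_mul_of_nonneg_left (hc n) (norm_nonneg _)
  refine ContinuousLinearMap.opNorm_le_bound _ hR fun x => ?_
  have hcl : IsClosed {x : L | ‖T x‖ ≤ R * ‖x‖} := isClosed_le (by fun_prop) (by fun_prop)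
  have hsub : (Submodule.span ℂ S : Set L) ⊆ {x : L | ‖T x‖ ≤ R * ‖x‖} := fun ζ hζ => by
    obtain ⟨c, hc⟩ := h' ζ hζ
    exact norm_apply_le_of_growth hT hR ζ hc
  exact hcl.closure_subset_iff.mpr hsub (hS x)

/-- The same criterion for a representation `σ` of a `*`-algebra. -/
theorem norm_rep_le_of_growth {X : Type*} [Ring X] [Algebra ℂ X] [StarRing X]
    (σ : X →⋆ₐ[ℂ] (L →L[ℂ] L)) {Y : Type*} [CStarAlgebra Y] (e : X →⋆ₐ[ℂ] Y) (S : Set L)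
    (hS : Dense (Submodule.span ℂ S : Set L))
    (h : ∀ ζ ∈ S, ∃ c : ℝ, ∀ x : X, ‖σ x ζ‖ ≤ c * ‖e x‖) (x : X) : ‖σ x‖ ≤ ‖e x‖ := by
  have key : ‖σ (star x * x)‖ ≤ ‖e (star x * x)‖ := by
    refine norm_le_of_growth ?_ (norm_nonneg _) S hS fun ζ hζ => ?_
    · rw [← map_star, star_mul, star_star]
    · obtain ⟨c, hc⟩ := h ζ hζ
      refine ⟨|c|, fun n => ?_⟩
      rw [← map_pow]
      refine (hc _).trans ?_
      rcases n with _ | n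
      · rw [pow_zero, pow_zero, map_one]
        have : ‖(1 : Y)‖ ≤ 1 := by
          cases subsingleton_or_nontrivial Y
          · simp [Subsingleton.elim (1 : Y) 0]
          · exact CStarRing.norm_one.le
        nlinarith [le_abs_self c, norm_nonneg (1 : Y), abs_nonneg c]
      · rw [map_pow]
        gcongr
        · exact le_abs_self c
        · exact norm_pow_le' _ n.succ_pos
  rw [map_mul, map_mul, map_star, map_star, CStarRing.norm_star_mul_self,
    CStarRing.norm_star_mul_self] at key
  exact (mul_self_le_mul_self_iff (norm_nonneg _) (norm_nonneg _)).mpr key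

end Growth

section VectorState

variable {A : Type*} {B : Type*} [CStarAlgebra A] [CStarAlgebra B]
  {H : Type*} {K : Type*}
  [NormedAddCommGroup H] [InnerProductSpace ℂ H] [CompleteSpace H]
  [NormedAddCommGroup K] [InnerProductSpace ℂ K] [CompleteSpace K]

theorem inner_star_mul_self_apply (T : H →L[ℂ] H) (ξ : H) :
    ⟪ξ, (star T * T) ξ⟫_ℂ = ((‖T ξ‖ ^ 2 : ℝ) : ℂ) := by
  have e : (star T * T) ξ = ContinuousLinearMap.adjoint T (T ξ) := rfl
  rw [e, ContinuousLinearMap.adjoint_inner_right, inner_self_eq_norm_sq_to_K]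
  simp

theorem inner_star_mul_self (σ : A →⋆ₐ[ℂ] (H →L[ℂ] H)) (ξ : H) (a : A) :
    ⟪ξ, σ (star a * a) ξ⟫_ℂ = ((‖σ a ξ‖ ^ 2 : ℝ) : ℂ) := by
  rw [map_mul, map_star, inner_star_mul_self_apply]

/-- The vector functional `a ↦ ⟪ξ, π a ξ⟫`. -/
def vecFunctional (π : A →⋆ₐ[ℂ] (H →L[ℂ] H)) (ξ : H) : A →ₗ[ℂ] ℂ where
  toFun a := ⟪ξ, π a ξ⟫_ℂ
  map_add' a b := by simp
  map_smul' c a := by simp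

/-- The vector state belonging to a unit vector. -/
def vecState (π : A →⋆ₐ[ℂ] (H →L[ℂ] H)) (ξ : H) (hξ : ‖ξ‖ = 1) : State A where
  toLinearMap := vecFunctional π ξ
  nonneg a := by
    change 0 ≤ ⟪ξ, π (star a * a) ξ⟫_ℂ
    rw [inner_star_mul_self]
    exact Complex.zero_le_real.mpr (sq_nonneg _)
  map_one := by
    change ⟪ξ, π 1 ξ⟫_ℂ = 1
    rw [map_one, one_apply_eq_self, inner_self_eq_norm_sq_to_K, hξ]
    simp

/-- The product functional `φ ⊙ ψ` on the algebraic tensor product. -/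
def prodFunctional (φ : A →ₗ[ℂ] ℂ) (ψ : B →ₗ[ℂ] ℂ) : A ⊗[ℂ] B →ₗ[ℂ] ℂ :=
  LinearMap.mul' ℂ ℂ ∘ₗ TensorProduct.map φ ψ

theorem inner_algRep (π : A →⋆ₐ[ℂ] (H →L[ℂ] H)) (ρ : B →⋆ₐ[ℂ] (K →L[ℂ] K)) (ξ : H) (η : K)
    (x : A ⊗[ℂ] B) : ⟪htmul ξ η, algRep π ρ x (htmul ξ η)⟫_ℂ =
      prodFunctional (vecFunctional π ξ) (vecFunctional ρ η) x := by
  induction x with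
  | zero => simp
  | add x y hx hy => simp only [map_add, add_apply, inner_add_right, hx, hy]
  | tmul a b => simp [prodFunctional, vecFunctional, inner_htmul]

theorem inner_algRep_star_mul_self (π : A →⋆ₐ[ℂ] (H →L[ℂ] H)) (ρ : B →⋆ₐ[ℂ] (K →L[ℂ] K))
    (ζ : HTensor H K) (x : A ⊗[ℂ] B) :
    ⟪ζ, algRep π ρ (star x * x) ζ⟫_ℂ = ((‖algRep π ρ x ζ‖ ^ 2 : ℝ) : ℂ) := by
  rw [map_mul, map_star, inner_star_mul_self_apply]

theorem vecFunctional_cyclic (φ : State A) : vecFunctional φ.gns φ.cyclic = φ.toLinearMap :=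
  LinearMap.ext φ.inner_cyclic

theorem norm_algRep_htmul_unit (π : A →⋆ₐ[ℂ] (H →L[ℂ] H)) (ρ : B →⋆ₐ[ℂ] (K →L[ℂ] K))
    (x : A ⊗[ℂ] B) (ξ : H) (η : K) (hξ : ‖ξ‖ = 1) (hη : ‖η‖ = 1) :
    ‖algRep π ρ x (htmul ξ η)‖ ≤ ‖incl A B x‖ := by
  set φ := vecState π ξ hξ
  set ψ := vecState ρ η hη
  have h1 : ((‖algRep π ρ x (htmul ξ η)‖ ^ 2 : ℝ) : ℂ) =
      ((‖algRep φ.gns ψ.gns x (htmul φ.cyclic ψ.cyclic)‖ ^ 2 : ℝ) : ℂ) := by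
    rw [← inner_algRep_star_mul_self, ← inner_algRep_star_mul_self, inner_algRep, inner_algRep,
      vecFunctional_cyclic, vecFunctional_cyclic]
    rfl
  have h2 := Complex.ofReal_injective h1
  have h3 : ‖algRep π ρ x (htmul ξ η)‖ = ‖algRep φ.gns ψ.gns x (htmul φ.cyclic ψ.cyclic)‖ :=
    (sq_eq_sq₀ (norm_nonneg _) (norm_nonneg _)).mp h2
  rw [h3]
  refine (ContinuousLinearMap.le_opNorm _ _).trans ?_
  rw [norm_htmul, State.norm_cyclic, State.norm_cyclic, mul_one, mul_one]
  exact norm_algRep_gns_le x φ ψ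

theorem norm_algRep_htmul_le (π : A →⋆ₐ[ℂ] (H →L[ℂ] H)) (ρ : B →⋆ₐ[ℂ] (K →L[ℂ] K))
    (x : A ⊗[ℂ] B) (ξ : H) (η : K) :
    ‖algRep π ρ x (htmul ξ η)‖ ≤ ‖ξ‖ * ‖η‖ * ‖incl A B x‖ := by
  by_cases hξ : ξ = 0
  · subst hξ
    have : htmul (0 : H) η = 0 := by simp [htmul]
    simp [this]
  by_cases hη : η = 0
  · subst hη
    have : htmul ξ (0 : K) = 0 := by simp [htmul]
    simp [this]
  have e1 : ((‖ξ‖ : ℝ) : ℂ) • ((‖ξ‖ : ℝ) : ℂ)⁻¹ • ξ = ξ :=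
    smul_inv_smul₀ (by simpa using hξ) ξ
  have e2 : ((‖η‖ : ℝ) : ℂ) • ((‖η‖ : ℝ) : ℂ)⁻¹ • η = η :=
    smul_inv_smul₀ (by simpa using hη) η
  have h := norm_algRep_htmul_unit π ρ x (((‖ξ‖ : ℝ) : ℂ)⁻¹ • ξ) (((‖η‖ : ℝ) : ℂ)⁻¹ • η)
    (by rw [norm_smul, norm_inv, Complex.norm_real, norm_norm,
      inv_mul_cancel₀ (norm_ne_zero_iff.mpr hξ)])
    (by rw [norm_smul, norm_inv, Complex.norm_real, norm_norm,
      inv_mul_cancel₀ (norm_ne_zero_iff.mpr hη)])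
  rw [← e1, ← e2, htmul_smul_left, htmul_smul_right, map_smul, map_smul, norm_smul, norm_smul,
    Complex.norm_real, Complex.norm_real, norm_norm, norm_norm, e1, e2, mul_assoc]
  gcongr

/-- The minimal tensor norm dominates every product representation. -/
theorem norm_algRep_le (π : A →⋆ₐ[ℂ] (H →L[ℂ] H)) (ρ : B →⋆ₐ[ℂ] (K →L[ℂ] K))
    (x : A ⊗[ℂ] B) : ‖algRep π ρ x‖ ≤ ‖incl A B x‖ := by
  refine norm_rep_le_of_growth (algRep π ρ) (incl A B) _ span_htmul_dense ?_ x
  rintro _ ⟨ξ, η, rfl⟩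
  exact ⟨‖ξ‖ * ‖η‖, fun x => norm_algRep_htmul_le π ρ x ξ η⟩

/-- The product representation `π ⊗ ρ` of the minimal tensor product on `H ⊗ K`. -/
def tensorRep (π : A →⋆ₐ[ℂ] (H →L[ℂ] H)) (ρ : B →⋆ₐ[ℂ] (K →L[ℂ] K)) :
    MinTensor A B →⋆ₐ[ℂ] (HTensor H K →L[ℂ] HTensor H K) :=
  extendHom (incl A B) (algRep π ρ) incl_dense (norm_algRep_le π ρ)

theorem tensorRep_incl (π : A →⋆ₐ[ℂ] (H →L[ℂ] H)) (ρ : B →⋆ₐ[ℂ] (K →L[ℂ] K)) (x : A ⊗[ℂ] B) :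
    tensorRep π ρ (incl A B x) = algRep π ρ x :=
  extendHom_apply _ _ _ _ x

end VectorState

section Map

variable {A : Type*} {B : Type*} {A' : Type*} {B' : Type*}
  [CStarAlgebra A] [CStarAlgebra B] [CStarAlgebra A'] [CStarAlgebra B']

/-- The tensor product of `*`-homomorphisms on the algebraic tensor product. -/
def starMap {X : Type*} {X' : Type*} {Y : Type*} {Y' : Type*}
    [Ring X] [Algebra ℂ X] [StarRing X] [StarModule ℂ X]
    [Ring X'] [Algebra ℂ X'] [StarRing X'] [StarModule ℂ X']
    [Ring Y] [Algebra ℂ Y] [StarRing Y] [StarModule ℂ Y]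
    [Ring Y'] [Algebra ℂ Y'] [StarRing Y'] [StarModule ℂ Y']
    (f : X →⋆ₐ[ℂ] Y) (g : X' →⋆ₐ[ℂ] Y') : X ⊗[ℂ] X' →⋆ₐ[ℂ] Y ⊗[ℂ] Y' :=
  { Algebra.TensorProduct.map f.toAlgHom g.toAlgHom with
    map_star' := fun x => by
      change Algebra.TensorProduct.map f.toAlgHom g.toAlgHom (star x) =
        star (Algebra.TensorProduct.map f.toAlgHom g.toAlgHom x)
      induction x with
      | zero => simp
      | add x y hx hy => simp only [star_add, map_add, hx, hy]
      | tmul a b => simp [map_star] }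

@[simp] theorem starMap_tmul {X : Type*} {X' : Type*} {Y : Type*} {Y' : Type*}
    [Ring X] [Algebra ℂ X] [StarRing X] [StarModule ℂ X]
    [Ring X'] [Algebra ℂ X'] [StarRing X'] [StarModule ℂ X']
    [Ring Y] [Algebra ℂ Y] [StarRing Y] [StarModule ℂ Y]
    [Ring Y'] [Algebra ℂ Y'] [StarRing Y'] [StarModule ℂ Y']
    (f : X →⋆ₐ[ℂ] Y) (g : X' →⋆ₐ[ℂ] Y') (x : X) (x' : X') :
    starMap f g (x ⊗ₜ x') = f x ⊗ₜ g x' := rfl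

/-- The map `f ⊙ g` from the algebraic tensor product to the minimal tensor product. -/
def algMap (f : A →⋆ₐ[ℂ] A') (g : B →⋆ₐ[ℂ] B') : A ⊗[ℂ] B →⋆ₐ[ℂ] MinTensor A' B' :=
  (incl A' B').comp (starMap f g)

@[simp] theorem algMap_tmul (f : A →⋆ₐ[ℂ] A') (g : B →⋆ₐ[ℂ] B') (a : A) (b : B) :
    algMap f g (a ⊗ₜ b) = mtmul (f a) (g b) := rfl

theorem tensorRep_algMap {H : Type*} {K : Type*}
    [NormedAddCommGroup H] [InnerProductSpace ℂ H] [CompleteSpace H]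
    [NormedAddCommGroup K] [InnerProductSpace ℂ K] [CompleteSpace K]
    (f : A →⋆ₐ[ℂ] A') (g : B →⋆ₐ[ℂ] B') (π : A' →⋆ₐ[ℂ] (H →L[ℂ] H)) (ρ : B' →⋆ₐ[ℂ] (K →L[ℂ] K))
    (x : A ⊗[ℂ] B) : tensorRep π ρ (algMap f g x) = algRep (π.comp f) (ρ.comp g) x := by
  induction x with
  | zero => simp
  | add x y hx hy => simp only [map_add, hx, hy]
  | tmul a b => simp [mtmul, tensorRep_incl]

theorem norm_le_of_tensorRep (y : MinTensor A B) {C : ℝ} (hC : 0 ≤ C)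
    (h : ∀ (φ : State A) (ψ : State B), ‖tensorRep φ.gns ψ.gns y‖ ≤ C) : ‖y‖ ≤ C := by
  refine le_of_forall_pos_le_add fun ε hε => ?_
  obtain ⟨x, hx⟩ := Metric.denseRange_iff.mp incl_dense y (ε / 2) (by positivity)
  rw [dist_eq_norm] at hx
  have h1 : ‖incl A B x‖ ≤ C + ε / 2 := norm_incl_le x (by positivity) fun φ ψ => by
    rw [← tensorRep_incl]
    have e : incl A B x = y - (y - incl A B x) := by abel
    rw [e, map_sub]
    refine (norm_sub_le _ _).trans (add_le_add (h φ ψ) ?_)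
    exact (NonUnitalStarAlgHom.norm_apply_le _ _).trans hx.le
  calc ‖y‖ = ‖(y - incl A B x) + incl A B x‖ := by rw [sub_add_cancel]
    _ ≤ ‖y - incl A B x‖ + ‖incl A B x‖ := norm_add_le _ _
    _ ≤ C + ε := by linarith

theorem norm_algMap_le (f : A →⋆ₐ[ℂ] A') (g : B →⋆ₐ[ℂ] B') (x : A ⊗[ℂ] B) :
    ‖algMap f g x‖ ≤ ‖incl A B x‖ :=
  norm_le_of_tensorRep _ (norm_nonneg _) fun φ ψ => by
    rw [tensorRep_algMap]
    exact norm_algRep_le _ _ x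

/-- The tensor product `f ⊗ g` of unital `*`-homomorphisms. -/
def MinTensor.map (f : A →⋆ₐ[ℂ] A') (g : B →⋆ₐ[ℂ] B') : MinTensor A B →⋆ₐ[ℂ] MinTensor A' B' :=
  extendHom (incl A B) (algMap f g) incl_dense (norm_algMap_le f g)

theorem MinTensor.map_incl (f : A →⋆ₐ[ℂ] A') (g : B →⋆ₐ[ℂ] B') (x : A ⊗[ℂ] B) :
    MinTensor.map f g (incl A B x) = algMap f g x :=
  extendHom_apply _ _ _ _ x

@[simp] theorem MinTensor.map_mtmul (f : A →⋆ₐ[ℂ] A') (g : B →⋆ₐ[ℂ] B') (a : A) (b : B) :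
    MinTensor.map f g (mtmul a b) = mtmul (f a) (g b) :=
  MinTensor.map_incl f g (a ⊗ₜ b)

end Map

section FaithfulStates

variable {A : Type*} [CStarAlgebra A]

/-- A unital functional of norm at most one is positive. -/
theorem nonneg_of_norm_le (g : A →L[ℂ] ℂ) (h1 : g 1 = 1) (hg : ∀ a, ‖g a‖ ≤ ‖a‖) (b : A) :
    0 ≤ g (star b * b) := by
  let _ := CStarAlgebra.spectralOrder A
  have _ := CStarAlgebra.spectralOrderedRing A
  set c := star b * b with hc
  have hc0 : 0 ≤ c := star_mul_self_nonneg b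
  have hsa : star c = c := by rw [hc, star_mul, star_star]
  have h1A : ‖(1 : A)‖ ≤ 1 := by
    cases subsingleton_or_nontrivial A
    · simp [Subsingleton.elim (1 : A) 0]
    · exact CStarRing.norm_one.le
  have him : (g c).im = 0 := by
    have key : ∀ r : ℝ, (g c).re ^ 2 + ((g c).im + r) ^ 2 ≤ ‖c‖ ^ 2 + r ^ 2 := fun r => by
      have e1 : g (c + (Complex.I * r) • (1 : A)) = g c + Complex.I * r := by
        rw [map_add, map_smul, h1, smul_eq_mul, mul_one]
      have e2 := hg (c + (Complex.I * r) • (1 : A))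
      have e3 : ‖c + (Complex.I * r) • (1 : A)‖ * ‖c + (Complex.I * r) • (1 : A)‖ ≤
          ‖c‖ ^ 2 + r ^ 2 := by
        rw [← CStarRing.norm_star_mul_self]
        have : star (c + (Complex.I * r) • (1 : A)) * (c + (Complex.I * r) • (1 : A)) =
            c * c + ((r ^ 2 : ℝ) : ℂ) • (1 : A) := by
          rw [star_add, star_smul, hsa, star_one]
          simp only [add_mul, mul_add, smul_mul_assoc, mul_smul_comm, one_mul, mul_one, smul_add, smul_smul,
            star_mul', Complex.star_def, Complex.conj_I, Complex.conj_ofReal]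
          have hI : Complex.I * r * (-Complex.I * r) = ((r ^ 2 : ℝ) : ℂ) := by
            push_cast
            linear_combination (-(r : ℂ) ^ 2) * Complex.I_sq
          rw [hI]
          simp only [neg_mul, neg_smul]
          abel
        rw [this]
        refine (norm_add_le _ _).trans (add_le_add ?_ ?_)
        · rw [sq]; exact norm_mul_le _ _
        · rw [norm_smul, Complex.norm_real, Real.norm_of_nonneg (sq_nonneg r)]
          exact mul_le_of_le_one_right (sq_nonneg r) h1A
      have e4 : ‖g c + Complex.I * r‖ ^ 2 = (g c).re ^ 2 + ((g c).im + r) ^ 2 := by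
        rw [← Complex.normSq_eq_norm_sq, Complex.normSq_apply]
        simp
        ring
      rw [← e4, ← e1, sq]
      exact (mul_self_le_mul_self (norm_nonneg _) e2).trans e3
    by_contra hne
    have := key ((‖c‖ ^ 2 + 1) / (2 * (g c).im))
    have h2 : 2 * (g c).im * ((‖c‖ ^ 2 + 1) / (2 * (g c).im)) = ‖c‖ ^ 2 + 1 := by
      field_simp
    nlinarith [sq_nonneg (g c).re, sq_nonneg (g c).im]
  have hre : 0 ≤ (g c).re := by
    have e1 : ‖((‖c‖ : ℝ) : ℂ) • (1 : A) - c‖ ≤ ‖c‖ := by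
      have h2 : c ≤ algebraMap ℝ A ‖c‖ := IsSelfAdjoint.le_algebraMap_norm_self hsa
      have e : ((‖c‖ : ℝ) : ℂ) • (1 : A) = algebraMap ℝ A ‖c‖ := by
        rw [Algebra.algebraMap_eq_smul_one, Complex.coe_smul]
      rw [e]
      rw [CStarAlgebra.norm_le_iff_le_algebraMap _ (norm_nonneg c) (sub_nonneg.mpr h2)]
      exact sub_le_self _ hc0
    have e2 := (hg _).trans e1
    rw [map_sub, map_smul, h1, smul_eq_mul, mul_one] at e2
    have e3 := (Complex.abs_re_le_norm _).trans e2
    simp only [Complex.sub_re, Complex.ofReal_re] at e3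
    linarith [(abs_le.mp e3).2]
  exact Complex.nonneg_iff.mpr ⟨hre, him.symm⟩

/-- The norm of an element of a C*-algebra is attained at some state. -/
theorem exists_state_norm [Nontrivial A] (c : A) :
    ∃ ω : State A, ω (star c * c) = ((‖c‖ ^ 2 : ℝ) : ℂ) := by
  let _ := CStarAlgebra.spectralOrder A
  have _ := CStarAlgebra.spectralOrderedRing A
  set s := star c * c with hs
  have hs0 : 0 ≤ s := star_mul_self_nonneg c
  have hsa : IsSelfAdjoint s := IsSelfAdjoint.of_nonneg hs0
  have hn : IsStarNormal s := hsa.isStarNormal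
  have hmem : ((‖s‖ : ℝ) : ℂ) ∈ spectrum ℂ s :=
    spectrum.algebraMap_mem ℂ (CStarAlgebra.norm_mem_spectrum_of_nonneg hs0)
  obtain ⟨χ, hχ⟩ := (StarAlgebra.elemental.characterSpaceHomeo s).surjective ⟨_, hmem⟩
  have hχs : χ ⟨s, StarAlgebra.elemental.self_mem ℂ s⟩ = ((‖s‖ : ℝ) : ℂ) :=
    congrArg Subtype.val hχ
  let p : Submodule ℂ A := (StarAlgebra.elemental ℂ s).toSubalgebra.toSubmodule
  have hχn : ∀ y : StarAlgebra.elemental ℂ s, ‖χ y‖ ≤ ‖y‖ := fun y =>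
    AlgHom.norm_apply_le_self χ y
  let f0 : p →ₗ[ℂ] ℂ :=
    { toFun := fun y => χ (⟨y.1, y.2⟩ : StarAlgebra.elemental ℂ s)
      map_add' := fun x y => map_add χ (⟨x.1, x.2⟩ : StarAlgebra.elemental ℂ s) ⟨y.1, y.2⟩
      map_smul' := fun a y => map_smul χ a (⟨y.1, y.2⟩ : StarAlgebra.elemental ℂ s) }
  let f : StrongDual ℂ p := f0.mkContinuous 1 fun y => by
    rw [one_mul]; exact hχn ⟨y.1, y.2⟩
  obtain ⟨g, hgf, hgn⟩ := exists_extension_norm_eq p f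
  have hg1 : g 1 = 1 := (hgf ⟨1, one_mem (StarAlgebra.elemental ℂ s)⟩).trans (map_one χ)
  have hgs : g s = ((‖s‖ : ℝ) : ℂ) := (hgf ⟨s, StarAlgebra.elemental.self_mem ℂ s⟩).trans hχs
  have hle : ∀ a, ‖g a‖ ≤ ‖a‖ := fun a => by
    refine (g.le_opNorm a).trans (mul_le_of_le_one_left (norm_nonneg a) ?_)
    rw [hgn]
    exact LinearMap.mkContinuous_norm_le _ zero_le_one _
  refine ⟨⟨g.toLinearMap, nonneg_of_norm_le g hg1 hle, hg1⟩, ?_⟩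
  change g s = _
  rw [hgs, hs, CStarRing.norm_star_mul_self, sq]

/-- An element of a C*-algebra is bounded by its images in the GNS representations. -/
theorem norm_le_of_gns (c : A) {C : ℝ} (hC : 0 ≤ C) (h : ∀ ω : State A, ‖ω.gns c‖ ≤ C) :
    ‖c‖ ≤ C := by
  cases subsingleton_or_nontrivial A
  · simpa [Subsingleton.elim c 0] using hC
  obtain ⟨ω, hω⟩ := exists_state_norm c
  rw [← ω.inner_cyclic, inner_star_mul_self] at hω
  have h1 : ‖ω.gns c ω.cyclic‖ = ‖c‖ :=
    (sq_eq_sq₀ (norm_nonneg _) (norm_nonneg _)).mp (Complex.ofReal_injective hω)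
  rw [← h1]
  refine (ContinuousLinearMap.le_opNorm _ _).trans ?_
  rw [ω.norm_cyclic, mul_one]
  exact h ω

end FaithfulStates

section Slice

variable {A : Type*} {B : Type*} [CStarAlgebra A] [CStarAlgebra B]
  {H : Type*} {K : Type*}
  [NormedAddCommGroup H] [InnerProductSpace ℂ H]
  [NormedAddCommGroup K] [InnerProductSpace ℂ K]

/-- The operator `η ↦ ξ ⊗ η`. -/
def creation (K : Type*) [NormedAddCommGroup K] [InnerProductSpace ℂ K] (ξ : H) :
    K →L[ℂ] HTensor H K :=
  LinearMap.mkContinuous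
    { toFun := fun η => htmul ξ η
      map_add' := htmul_add_right ξ
      map_smul' := fun c η => htmul_smul_right c ξ η }
    ‖ξ‖ (fun η => (norm_htmul ξ η).le)

@[simp] theorem creation_apply (ξ : H) (η : K) : creation K ξ η = htmul ξ η := rfl

theorem norm_creation_le (ξ : H) : ‖creation K ξ‖ ≤ ‖ξ‖ :=
  LinearMap.mkContinuous_norm_le _ (norm_nonneg _) _

variable [CompleteSpace K]

/-- The adjoint of `η ↦ ξ ⊗ η`. -/
def annihilation (K : Type*) [NormedAddCommGroup K] [InnerProductSpace ℂ K]
    [CompleteSpace K] (ξ : H) : HTensor H K →L[ℂ] K :=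
  ContinuousLinearMap.adjoint (creation K ξ)

@[simp] theorem annihilation_htmul (ξ ζ : H) (η : K) :
    annihilation K ξ (htmul ζ η) = ⟪ξ, ζ⟫_ℂ • η := by
  refine ext_inner_left ℂ fun v => ?_
  rw [annihilation, ContinuousLinearMap.adjoint_inner_right, creation_apply, inner_htmul,
    inner_smul_right]

theorem norm_annihilation_le (ξ : H) : ‖annihilation K ξ‖ ≤ ‖ξ‖ := by
  rw [annihilation, LinearIsometryEquiv.norm_map]
  exact norm_creation_le ξ

variable [CompleteSpace H]

/-- The slice map `f ⊙ id` on the algebraic tensor product. -/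
def algSlice {X Y : Type*} [AddCommGroup X] [Module ℂ X] [AddCommGroup Y] [Module ℂ Y]
    (f : X →ₗ[ℂ] ℂ) : X ⊗[ℂ] Y →ₗ[ℂ] Y :=
  (TensorProduct.lid ℂ Y).toLinearMap ∘ₗ TensorProduct.map f LinearMap.id

@[simp] theorem algSlice_tmul {X Y : Type*} [AddCommGroup X] [Module ℂ X] [AddCommGroup Y]
    [Module ℂ Y] (f : X →ₗ[ℂ] ℂ) (x : X) (y : Y) : algSlice f (x ⊗ₜ y) = f x • y := by
  simp [algSlice]

theorem rep_algSlice (π : A →⋆ₐ[ℂ] (H →L[ℂ] H)) (ρ : B →⋆ₐ[ℂ] (K →L[ℂ] K)) (ξ : H)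
    (x : A ⊗[ℂ] B) : ρ (algSlice (vecFunctional π ξ) x) =
      (annihilation K ξ).comp ((algRep π ρ x).comp (creation K ξ)) := by
  induction x with
  | zero => simp
  | add x y hx hy =>
    simp only [map_add, hx, hy, ContinuousLinearMap.add_comp, ContinuousLinearMap.comp_add]
  | tmul a b =>
    ext η
    simp [vecFunctional]

theorem norm_rep_algSlice_le (π : A →⋆ₐ[ℂ] (H →L[ℂ] H)) (ρ : B →⋆ₐ[ℂ] (K →L[ℂ] K)) (ξ : H)
    (x : A ⊗[ℂ] B) : ‖ρ (algSlice (vecFunctional π ξ) x)‖ ≤ ‖ξ‖ * (‖incl A B x‖ * ‖ξ‖) := by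
  rw [rep_algSlice]
  refine (ContinuousLinearMap.opNorm_comp_le _ _).trans ?_
  gcongr
  · exact norm_annihilation_le ξ
  · refine (ContinuousLinearMap.opNorm_comp_le _ _).trans ?_
    gcongr
    · exact norm_algRep_le π ρ x
    · exact norm_creation_le ξ

theorem norm_algSlice_le (μ : State A) (x : A ⊗[ℂ] B) :
    ‖algSlice μ.toLinearMap x‖ ≤ ‖incl A B x‖ := by
  refine norm_le_of_gns _ (norm_nonneg _) fun ω => ?_
  have := norm_rep_algSlice_le μ.gns ω.gns μ.cyclic x
  rwa [vecFunctional_cyclic, μ.norm_cyclic, one_mul, mul_one] at this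

/-- The slice map `μ ⊗ id : A ⊗ B → B` of a state `μ` of `A`. -/
def slice (μ : State A) : MinTensor A B →L[ℂ] B :=
  LinearMap.extendOfNorm (algSlice μ.toLinearMap) (incl A B).toAlgHom.toLinearMap

theorem slice_incl (μ : State A) (x : A ⊗[ℂ] B) :
    slice μ (incl A B x) = algSlice μ.toLinearMap x :=
  LinearMap.extendOfNorm_eq (f := algSlice μ.toLinearMap) (e := (incl A B).toAlgHom.toLinearMap)
    incl_dense ⟨1, fun x => by simpa using norm_algSlice_le μ x⟩ x

@[simp] theorem slice_mtmul (μ : State A) (a : A) (b : B) :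
    slice μ (mtmul a b) = μ a • b := by
  simp [mtmul, slice_incl]

end Slice

section Assoc

variable {A : Type*} {B : Type*} {C : Type*} [CStarAlgebra A] [CStarAlgebra B] [CStarAlgebra C]

/-- The canonical map `(A ⊙ B) ⊙ C → (A ⊗ B) ⊗ C`. -/
def inclLeft (A : Type*) (B : Type*) (C : Type*) [CStarAlgebra A] [CStarAlgebra B]
    [CStarAlgebra C] : (A ⊗[ℂ] B) ⊗[ℂ] C →⋆ₐ[ℂ] MinTensor (MinTensor A B) C :=
  (incl (MinTensor A B) C).comp (starMap (incl A B) (StarAlgHom.id ℂ C))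

@[simp] theorem inclLeft_tmul (a : A) (b : B) (c : C) :
    inclLeft A B C ((a ⊗ₜ b) ⊗ₜ c) = mtmul (mtmul a b) c := rfl

/-- The associativity isomorphism of the algebraic tensor product, as a `*`-homomorphism. -/
def starAssoc (A : Type*) (B : Type*) (C : Type*) [CStarAlgebra A] [CStarAlgebra B]
    [CStarAlgebra C] : (A ⊗[ℂ] B) ⊗[ℂ] C →⋆ₐ[ℂ] A ⊗[ℂ] (B ⊗[ℂ] C) :=
  { (Algebra.TensorProduct.assoc ℂ ℂ ℂ A B C).toAlgHom with
    map_star' := fun x => by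
      change Algebra.TensorProduct.assoc ℂ ℂ ℂ A B C (star x) =
        star (Algebra.TensorProduct.assoc ℂ ℂ ℂ A B C x)
      induction x with
      | zero => simp
      | add x y hx hy => simp only [star_add, map_add, hx, hy]
      | tmul z c =>
        induction z with
        | zero => simp
        | add x y hx hy =>
          simp only [TensorProduct.star_tmul] at hx hy
          simp only [TensorProduct.star_tmul, star_add, TensorProduct.add_tmul, map_add, hx, hy]
        | tmul a b => simp }

@[simp] theorem starAssoc_tmul (a : A) (b : B) (c : C) :
    starAssoc A B C ((a ⊗ₜ b) ⊗ₜ c) = a ⊗ₜ (b ⊗ₜ c) := rfl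

/-- The canonical map `(A ⊙ B) ⊙ C → A ⊙ (B ⊗ C)`. -/
def inclRightAux (A : Type*) (B : Type*) (C : Type*) [CStarAlgebra A] [CStarAlgebra B]
    [CStarAlgebra C] : (A ⊗[ℂ] B) ⊗[ℂ] C →⋆ₐ[ℂ] A ⊗[ℂ] MinTensor B C :=
  (starMap (StarAlgHom.id ℂ A) (incl B C)).comp (starAssoc A B C)

@[simp] theorem inclRightAux_tmul (a : A) (b : B) (c : C) :
    inclRightAux A B C ((a ⊗ₜ b) ⊗ₜ c) = a ⊗ₜ mtmul b c := rfl

/-- The canonical map `(A ⊙ B) ⊙ C → A ⊗ (B ⊗ C)`. -/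
def inclRight (A : Type*) (B : Type*) (C : Type*) [CStarAlgebra A] [CStarAlgebra B]
    [CStarAlgebra C] : (A ⊗[ℂ] B) ⊗[ℂ] C →⋆ₐ[ℂ] MinTensor A (MinTensor B C) :=
  (incl A (MinTensor B C)).comp (inclRightAux A B C)

theorem inclLeft_dense : DenseRange (inclLeft A B C) := by
  let V : Submodule ℂ (MinTensor (MinTensor A B) C) :=
    (LinearMap.range (inclLeft A B C).toAlgHom.toLinearMap).topologicalClosure
  have hV : IsClosed (V : Set (MinTensor (MinTensor A B) C)) :=
    Submodule.isClosed_topologicalClosure _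
  have hsub : ∀ x, inclLeft A B C x ∈ V := fun x =>
    Submodule.le_topologicalClosure _ ⟨x, rfl⟩
  have hmt : ∀ (y : MinTensor A B) (c : C), mtmul y c ∈ V := fun y c => by
    refine incl_dense.induction_on (p := fun y : MinTensor A B => mtmul y c ∈ V) y
      (hV.preimage ?_) fun z => hsub (z ⊗ₜ c)
    let F : MinTensor A B →ₗ[ℂ] MinTensor (MinTensor A B) C :=
      (incl (MinTensor A B) C).toAlgHom.toLinearMap ∘ₗ (TensorProduct.mk ℂ (MinTensor A B) C).flip c
    have hF : ∀ y, ‖F y‖ ≤ ‖c‖ * ‖y‖ := fun y => by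
      refine norm_incl_le (y ⊗ₜ c) (by positivity) fun φ ψ => ?_
      rw [algRep_tmul, mul_comm]
      refine (norm_opTensor_le _ _).trans ?_
      gcongr <;> exact NonUnitalStarAlgHom.norm_apply_le _ _
    exact (F.mkContinuous ‖c‖ hF).continuous
  have hall : ∀ x : (MinTensor A B) ⊗[ℂ] C, incl _ _ x ∈ V := fun x => by
    induction x with
    | zero => rw [map_zero]; exact V.zero_mem
    | add x y hx hy => rw [map_add]; exact V.add_mem hx hy
    | tmul y c => exact hmt y c
  intro z
  have : z ∈ (V : Set (MinTensor (MinTensor A B) C)) :=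
    incl_dense.induction_on (p := fun z => z ∈ (V : Set (MinTensor (MinTensor A B) C))) z hV hall
  exact this

/-- The slice map `f ⊙ id ⊙ id`. -/
def algSlice₃ (f : A →ₗ[ℂ] ℂ) : (A ⊗[ℂ] B) ⊗[ℂ] C →ₗ[ℂ] B ⊗[ℂ] C :=
  TensorProduct.map (algSlice f) LinearMap.id

theorem algSlice_inclRightAux (f : A →ₗ[ℂ] ℂ) (x : (A ⊗[ℂ] B) ⊗[ℂ] C) :
    algSlice f (inclRightAux A B C x) = incl B C (algSlice₃ f x) := by
  induction x with
  | zero => simp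
  | add x y hx hy => simp only [map_add, hx, hy]
  | tmul z c =>
    induction z with
    | zero => simp
    | add x y hx hy => simp only [TensorProduct.add_tmul, map_add, hx, hy]
    | tmul a b =>
      rw [inclRightAux_tmul, algSlice_tmul, algSlice₃, TensorProduct.map_tmul, algSlice_tmul,
        LinearMap.id_apply, ← TensorProduct.smul_tmul', map_smul]
      rfl

section
variable {H : Type*} {K : Type*} {L : Type*}
  [NormedAddCommGroup H] [InnerProductSpace ℂ H] [CompleteSpace H]
  [NormedAddCommGroup K] [InnerProductSpace ℂ K] [CompleteSpace K]
  [NormedAddCommGroup L] [InnerProductSpace ℂ L] [CompleteSpace L]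

theorem algRep_algSlice₃ (π : A →⋆ₐ[ℂ] (H →L[ℂ] H)) (ρ : B →⋆ₐ[ℂ] (K →L[ℂ] K))
    (σ : C →⋆ₐ[ℂ] (L →L[ℂ] L)) (ξ : H) (x : (A ⊗[ℂ] B) ⊗[ℂ] C) :
    algRep ρ σ (algSlice₃ (vecFunctional π ξ) x) =
      (opTensor (annihilation K ξ) (1 : L →L[ℂ] L)).comp
        ((algRep (tensorRep π ρ) σ (starMap (incl A B) (StarAlgHom.id ℂ C) x)).comp
          (opTensor (creation K ξ) (1 : L →L[ℂ] L))) := by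
  induction x with
  | zero => simp
  | add x y hx hy =>
    simp only [map_add, hx, hy, ContinuousLinearMap.add_comp, ContinuousLinearMap.comp_add]
  | tmul z c =>
    induction z with
    | zero => simp
    | add x y hx hy =>
      simp only [TensorProduct.add_tmul, map_add, hx, hy, ContinuousLinearMap.add_comp,
        ContinuousLinearMap.comp_add]
    | tmul a b =>
      refine ext_htmul fun u v => ?_
      simp [algSlice₃, tensorRep_incl, vecFunctional, htmul_smul_left]

theorem norm_algSlice₃_le (π : A →⋆ₐ[ℂ] (H →L[ℂ] H)) (ξ : H) (x : (A ⊗[ℂ] B) ⊗[ℂ] C) :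
    ‖incl B C (algSlice₃ (vecFunctional π ξ) x)‖ ≤ ‖ξ‖ * (‖inclLeft A B C x‖ * ‖ξ‖) := by
  refine norm_incl_le _ (by positivity) fun ψ ω => ?_
  rw [algRep_algSlice₃]
  have h1 : ‖(1 : ω.GNSSpace →L[ℂ] ω.GNSSpace)‖ ≤ 1 := ContinuousLinearMap.norm_id_le
  refine (ContinuousLinearMap.opNorm_comp_le _ _).trans ?_
  gcongr
  · refine (norm_opTensor_le _ _).trans ?_
    exact (mul_le_of_le_one_right (norm_nonneg _) h1).trans (norm_annihilation_le ξ)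
  · refine (ContinuousLinearMap.opNorm_comp_le _ _).trans ?_
    gcongr
    · exact norm_algRep_le _ _ _
    · refine (norm_opTensor_le _ _).trans ?_
      exact (mul_le_of_le_one_right (norm_nonneg _) h1).trans (norm_creation_le ξ)

end

theorem norm_inclRight_le (x : (A ⊗[ℂ] B) ⊗[ℂ] C) : ‖inclRight A B C x‖ ≤ ‖inclLeft A B C x‖ := by
  refine norm_incl_le _ (norm_nonneg _) fun φ χ => ?_
  refine norm_rep_le_of_growth ((algRep φ.gns χ.gns).comp (inclRightAux A B C)) (inclLeft A B C)
    _ span_htmul_dense ?_ x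
  rintro _ ⟨ξ, η, rfl⟩
  refine ⟨‖ξ‖ * ‖η‖, fun x => ?_⟩
  set y := inclRightAux A B C x with hy
  change ‖algRep φ.gns χ.gns y (htmul ξ η)‖ ≤ _
  have e1 : ((‖algRep φ.gns χ.gns y (htmul ξ η)‖ ^ 2 : ℝ) : ℂ) =
      ⟪η, χ.gns (algSlice (vecFunctional φ.gns ξ) (star y * y)) η⟫_ℂ := by
    rw [← inner_algRep_star_mul_self, rep_algSlice, ContinuousLinearMap.comp_apply,
      ContinuousLinearMap.comp_apply, annihilation, ContinuousLinearMap.adjoint_inner_right,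
      creation_apply]
  have e2 : ‖algRep φ.gns χ.gns y (htmul ξ η)‖ ^ 2 ≤
      ‖η‖ * (‖algSlice (vecFunctional φ.gns ξ) (star y * y)‖ * ‖η‖) := by
    have h := norm_inner_le_norm (𝕜 := ℂ) η
      (χ.gns (algSlice (vecFunctional φ.gns ξ) (star y * y)) η)
    rw [← e1, Complex.norm_real, Real.norm_of_nonneg (by positivity)] at h
    refine h.trans ?_
    gcongr
    refine (ContinuousLinearMap.le_opNorm _ _).trans ?_
    gcongr
    exact NonUnitalStarAlgHom.norm_apply_le _ _
  have e3 : ‖algSlice (vecFunctional φ.gns ξ) (star y * y)‖ ≤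
      ‖ξ‖ * (‖inclLeft A B C x‖ ^ 2 * ‖ξ‖) := by
    rw [hy, ← map_star, ← map_mul, algSlice_inclRightAux]
    refine (norm_algSlice₃_le _ _ _).trans (le_of_eq ?_)
    rw [map_mul, map_star, CStarRing.norm_star_mul_self, sq]
  refine (sq_le_sq₀ (norm_nonneg _) (by positivity)).mp (e2.trans ?_)
  calc _ ≤ ‖η‖ * (‖ξ‖ * (‖inclLeft A B C x‖ ^ 2 * ‖ξ‖) * ‖η‖) := by gcongr
    _ = _ := by ring

/-- The canonical isomorphism `(A ⊗ B) ⊗ C → A ⊗ (B ⊗ C)`, as a `*`-homomorphism. -/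
def MinTensor.assoc (A : Type*) (B : Type*) (C : Type*) [CStarAlgebra A] [CStarAlgebra B]
    [CStarAlgebra C] : MinTensor (MinTensor A B) C →⋆ₐ[ℂ] MinTensor A (MinTensor B C) :=
  extendHom (inclLeft A B C) (inclRight A B C) inclLeft_dense norm_inclRight_le

@[simp] theorem MinTensor.assoc_mtmul (a : A) (b : B) (c : C) :
    MinTensor.assoc A B C (mtmul (mtmul a b) c) = mtmul a (mtmul b c) :=
  extendHom_apply _ _ _ _ ((a ⊗ₜ b) ⊗ₜ c)

end Assoc

section Quotient

variable {B : Type u} [CStarAlgebra B]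

/-- Approximate units in a closed ideal: for `j ∈ I` there is `e ∈ I` selfadjoint with
`‖1 - e‖ ≤ 1` and `‖j (1 - e)‖` small. -/
theorem exists_approx_unit (I : Ideal B) [I.IsTwoSided] {j : B} (hj : j ∈ I) {ε : ℝ} (hε : 0 < ε) :
    ∃ e ∈ I, star e = e ∧ ‖1 - e‖ ≤ 1 ∧ ‖j * (1 - e)‖ ≤ ε := by
  let _ := CStarAlgebra.spectralOrder B
  have _ := CStarAlgebra.spectralOrderedRing B
  set s := star j * j with hs
  have hs0 : 0 ≤ s := star_mul_self_nonneg j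
  have hsa : IsSelfAdjoint s := IsSelfAdjoint.of_nonneg hs0
  have hspec : ∀ t ∈ spectrum ℝ s, 0 ≤ t := fun t ht => spectrum_nonneg_of_nonneg hs0 ht
  set δ := ε ^ 2 with hδ
  have hδ0 : 0 < δ := by positivity
  have hne : ∀ t ∈ spectrum ℝ s, δ + t ≠ 0 := fun t ht => by linarith [hspec t ht]
  have hc1 : ContinuousOn (fun t : ℝ => (δ + t)⁻¹) (spectrum ℝ s) :=
    (continuousOn_const.add continuousOn_id).inv₀ hne
  have hc2 : ContinuousOn (fun t : ℝ => δ * (δ + t)⁻¹) (spectrum ℝ s) := continuousOn_const.mul hc1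
  set k := cfc (fun t : ℝ => (δ + t)⁻¹) s with hk
  set e := k * s with he
  have hid : cfc (fun t : ℝ => t) s = s := cfc_id' ℝ s
  have he' : e = cfc (fun t : ℝ => (δ + t)⁻¹ * t) s := by
    rw [cfc_mul (fun t : ℝ => (δ + t)⁻¹) (fun t => t) s hc1 continuousOn_id, hid]
  have hu : 1 - e = cfc (fun t : ℝ => δ * (δ + t)⁻¹) s := by
    rw [he', ← cfc_one ℝ s, ← cfc_sub (1 : ℝ → ℝ) (fun t => (δ + t)⁻¹ * t) s continuousOn_const
      (hc1.mul continuousOn_id)]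
    refine cfc_congr fun t ht => ?_
    have := hne t ht
    simp only [Pi.one_apply]
    field_simp
    ring
  have husa : star (1 - e) = 1 - e := by
    rw [hu]
    exact (cfc_predicate (R := ℝ) _ s : IsSelfAdjoint _)
  refine ⟨e, ?_, ?_, ?_, ?_⟩
  · exact I.mul_mem_left _ (I.mul_mem_left _ hj)
  · have := husa
    rw [star_sub, star_one] at this
    exact sub_right_injective this
  · rw [hu]
    refine norm_cfc_le zero_le_one fun t ht => ?_
    have h0 := hspec t ht
    rw [Real.norm_of_nonneg (by positivity), ← div_eq_mul_inv, div_le_one (by positivity)]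
    linarith
  · have h1 : ‖j * (1 - e)‖ * ‖j * (1 - e)‖ ≤ δ := by
      rw [← CStarRing.norm_star_mul_self, star_mul, husa]
      have : (1 - e) * star j * (j * (1 - e)) =
          cfc (fun t : ℝ => δ * (δ + t)⁻¹ * t * (δ * (δ + t)⁻¹)) s := by
        rw [cfc_mul (fun t : ℝ => δ * (δ + t)⁻¹ * t) (fun t => δ * (δ + t)⁻¹) s
          (hc2.mul continuousOn_id) hc2, cfc_mul (fun t : ℝ => δ * (δ + t)⁻¹) (fun t => t) s
          hc2 continuousOn_id, hid, ← hu]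
        simp only [hs, mul_assoc]
      rw [this]
      refine norm_cfc_le hδ0.le fun t ht => ?_
      have h0 := hspec t ht
      rw [Real.norm_of_nonneg (by positivity)]
      have hq : δ * (δ + t)⁻¹ ≤ 1 := by
        rw [← div_eq_mul_inv, div_le_one (by positivity)]; linarith
      have hq2 : (δ + t)⁻¹ * t ≤ 1 := by
        rw [inv_mul_le_iff₀ (by positivity)]; linarith
      calc δ * (δ + t)⁻¹ * t * (δ * (δ + t)⁻¹) = δ * ((δ + t)⁻¹ * t) * (δ * (δ + t)⁻¹) := by ring
        _ ≤ δ * 1 * 1 := by gcongr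
        _ = δ := by ring
    rw [← sq, hδ] at h1
    exact (sq_le_sq₀ (norm_nonneg _) hε.le).mp h1

theorem star_mem_of_mem (I : Ideal B) [I.IsTwoSided] [hI : IsClosed (I : Set B)] {j : B}
    (hj : j ∈ I) : star j ∈ I := by
  have : star j ∈ closure (I : Set B) := Metric.mem_closure_iff.mpr fun ε hε => by
    obtain ⟨e, heI, hes, -, hje⟩ := exists_approx_unit I hj (half_pos hε)
    refine ⟨e * star j, I.mul_mem_right _ heI, ?_⟩
    rw [dist_eq_norm, ← norm_star, star_sub, star_mul, star_star, hes]
    calc ‖j - j * e‖ = ‖j * (1 - e)‖ := by rw [mul_sub, mul_one]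
      _ ≤ ε / 2 := hje
      _ < ε := half_lt_self hε
  rwa [hI.closure_eq] at this

variable (I : Ideal B) [I.IsTwoSided] [hI : IsClosed (I : Set B)]

/-- The quotient of a unital C*-algebra by a closed two-sided ideal, with the quotient norm. -/
instance quotientNormedRing : NormedRing (B ⧸ I) :=
  { (inferInstance : Ring (B ⧸ I)), (Submodule.Quotient.normedAddCommGroup I) with
    norm_mul_le := fun x y => by
      refine le_of_forall_pos_le_add fun ε hε => ?_
      have ht : Filter.Tendsto (fun d : ℝ => (‖x‖ + d) * (‖y‖ + d)) (nhdsWithin 0 (Set.Ioi 0))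
          (nhds (‖x‖ * ‖y‖)) := by
        have : Continuous fun d : ℝ => (‖x‖ + d) * (‖y‖ + d) := by fun_prop
        have h := (this.tendsto 0).mono_left (nhdsWithin_le_nhds (s := Set.Ioi 0))
        simpa using h
      have hev := ht.eventually (gt_mem_nhds (show ‖x‖ * ‖y‖ < ‖x‖ * ‖y‖ + ε by linarith))
      obtain ⟨d, hd1, hd0⟩ := (hev.and self_mem_nhdsWithin).exists
      obtain ⟨a, rfl, ha⟩ := QuotientAddGroup.exists_norm_mk_lt (S := I.toAddSubgroup) x hd0
      obtain ⟨b, rfl, hb⟩ := QuotientAddGroup.exists_norm_mk_lt (S := I.toAddSubgroup) y hd0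
      calc _ ≤ ‖a * b‖ := QuotientAddGroup.norm_mk_le_norm (S := I.toAddSubgroup) (m := a * b)
        _ ≤ ‖a‖ * ‖b‖ := norm_mul_le _ _
        _ ≤ _ := (mul_le_mul ha.le hb.le (norm_nonneg _) (by positivity)).trans hd1.le }

theorem norm_mk_le (b : B) : ‖Ideal.Quotient.mk I b‖ ≤ ‖b‖ :=
  QuotientAddGroup.norm_mk_le_norm (S := I.toAddSubgroup) (m := b)

theorem exists_mk_norm_lt (x : B ⧸ I) {ε : ℝ} (hε : 0 < ε) :
    ∃ b, Ideal.Quotient.mk I b = x ∧ ‖b‖ < ‖x‖ + ε :=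
  QuotientAddGroup.exists_norm_mk_lt (S := I.toAddSubgroup) x hε

instance quotientStar : Star (B ⧸ I) where
  star := Quotient.map' star fun a b h => by
    rw [Submodule.quotientRel_def] at h ⊢
    rw [← star_sub]
    exact star_mem_of_mem I h

theorem star_mk (b : B) : star (Ideal.Quotient.mk I b) = Ideal.Quotient.mk I (star b) := rfl

instance quotientStarRing : StarRing (B ⧸ I) where
  star_involutive x := by
    obtain ⟨a, rfl⟩ := Ideal.Quotient.mk_surjective x
    rw [star_mk, star_mk, star_star]
  star_mul x y := by
    obtain ⟨a, rfl⟩ := Ideal.Quotient.mk_surjective x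
    obtain ⟨b, rfl⟩ := Ideal.Quotient.mk_surjective y
    rw [← map_mul, star_mk, star_mk, star_mk, star_mul, map_mul]
  star_add x y := by
    obtain ⟨a, rfl⟩ := Ideal.Quotient.mk_surjective x
    obtain ⟨b, rfl⟩ := Ideal.Quotient.mk_surjective y
    rw [← map_add, star_mk, star_mk, star_mk, star_add, map_add]

/-- The quotient of a unital C*-algebra by a closed two-sided ideal is a C*-algebra. -/
instance quotientCStarAlgebra : CStarAlgebra (B ⧸ I) :=
  { quotientNormedRing I, quotientStarRing I,
    (inferInstance : Algebra ℂ (B ⧸ I)) with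
    toCompleteSpace := Submodule.Quotient.completeSpace I
    norm_smul_le := fun c x => by
      refine le_of_forall_pos_le_add fun ε hε => ?_
      obtain ⟨b, rfl, hb⟩ := exists_mk_norm_lt I x (ε := ε / (‖c‖ + 1)) (by positivity)
      calc _ ≤ ‖c • b‖ := norm_mk_le I (c • b)
        _ = ‖c‖ * ‖b‖ := norm_smul _ _
        _ ≤ ‖c‖ * (‖Ideal.Quotient.mk I b‖ + ε / (‖c‖ + 1)) := by gcongr
        _ = ‖c‖ * ‖Ideal.Quotient.mk I b‖ + ‖c‖ / (‖c‖ + 1) * ε := by ring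
        _ ≤ ‖c‖ * ‖Ideal.Quotient.mk I b‖ + 1 * ε := by
          gcongr
          rw [div_le_one (by positivity)]
          linarith
        _ = _ := by rw [one_mul]
    star_smul := fun c x => by
      obtain ⟨b, rfl⟩ := Ideal.Quotient.mk_surjective x
      change Ideal.Quotient.mk I (star (c • b)) = _
      rw [star_smul]
      rfl
    norm_mul_self_le := fun x => by
      obtain ⟨a, rfl⟩ := Ideal.Quotient.mk_surjective x
      refine le_of_forall_pos_le_add fun ε hε => ?_
      obtain ⟨b, hb, hbn⟩ := exists_mk_norm_lt I
        (star (Ideal.Quotient.mk I a) * Ideal.Quotient.mk I a) (half_pos hε)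
      have hj : star a * a - b ∈ I := by
        rw [← Ideal.Quotient.eq, hb, map_mul, star_mk]
      obtain ⟨e, heI, hes, he1, hje⟩ := exists_approx_unit I hj (half_pos hε)
      have hmk : Ideal.Quotient.mk I a = Ideal.Quotient.mk I (a * (1 - e)) := by
        rw [Ideal.Quotient.eq, mul_sub, mul_one, sub_sub_cancel]
        exact I.mul_mem_left _ heI
      have hus : star (1 - e) = 1 - e := by rw [star_sub, star_one, hes]
      have h1 : ‖a * (1 - e)‖ * ‖a * (1 - e)‖ ≤ ‖b‖ + ε / 2 := by
        rw [← CStarRing.norm_star_mul_self, star_mul, hus]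
        have e1 : (1 - e) * star a * (a * (1 - e)) =
            (1 - e) * ((star a * a - b) * (1 - e)) + (1 - e) * (b * (1 - e)) := by noncomm_ring
        rw [e1, add_comm]
        refine (norm_add_le _ _).trans (add_le_add ?_ ?_)
        · calc _ ≤ ‖1 - e‖ * (‖b‖ * ‖1 - e‖) :=
                (norm_mul_le _ _).trans (by gcongr; exact norm_mul_le _ _)
            _ ≤ 1 * (‖b‖ * 1) := by gcongr
            _ = ‖b‖ := by ring
        · calc _ ≤ ‖1 - e‖ * ‖(star a * a - b) * (1 - e)‖ := norm_mul_le _ _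
            _ ≤ 1 * (ε / 2) := by gcongr
            _ = ε / 2 := by ring
      calc ‖Ideal.Quotient.mk I a‖ * ‖Ideal.Quotient.mk I a‖
          = ‖Ideal.Quotient.mk I (a * (1 - e))‖ * ‖Ideal.Quotient.mk I (a * (1 - e))‖ := by
            rw [← hmk]
        _ ≤ ‖a * (1 - e)‖ * ‖a * (1 - e)‖ := by gcongr <;> exact norm_mk_le I _
        _ ≤ ‖b‖ + ε / 2 := h1
        _ ≤ _ := by linarith }

/-- The quotient map `B → B / I`. -/
def quotientMap : B →⋆ₐ[ℂ] B ⧸ I :=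
  { Ideal.Quotient.mkₐ ℂ I with
    map_star' := fun _ => rfl }

@[simp] theorem quotientMap_apply (b : B) : quotientMap I b = Ideal.Quotient.mk I b := rfl

end Quotient

/-- A compact quantum group: a unital C*-algebra `A` with a coassociative comultiplication
`Δ : A → A ⊗ A` such that the linear spans of `Δ(A)(1 ⊗ A)` and `Δ(A)(A ⊗ 1)` are dense. -/
structure CompactQuantumGroup (A : Type u) [CStarAlgebra A] where
  comul : A →⋆ₐ[ℂ] MinTensor A A
  coassoc : ∀ a, MinTensor.assoc A A A (MinTensor.map comul (StarAlgHom.id ℂ A) (comul a)) =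
    MinTensor.map (StarAlgHom.id ℂ A) comul (comul a)
  dense_one_tmul : Dense (Submodule.span ℂ
    {x : MinTensor A A | ∃ a b : A, x = comul a * mtmul 1 b} : Set (MinTensor A A))
  dense_tmul_one : Dense (Submodule.span ℂ
    {x : MinTensor A A | ∃ a b : A, x = comul a * mtmul b 1} : Set (MinTensor A A))

/-- An action of a compact quantum group `(A, Δ)` on a unital C*-algebra `B`: a unital
`*`-homomorphism `α : B → B ⊗ A` with `(α ⊗ id)α = (id ⊗ Δ)α` such that the linear span of
`α(B)(1 ⊗ A)` is dense. -/
structure Action {A : Type u} [CStarAlgebra A] (G : CompactQuantumGroup A)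
    (B : Type v) [CStarAlgebra B] where
  toHom : B →⋆ₐ[ℂ] MinTensor B A
  coassoc : ∀ b, MinTensor.assoc B A A (MinTensor.map toHom (StarAlgHom.id ℂ A) (toHom b)) =
    MinTensor.map (StarAlgHom.id ℂ B) G.comul (toHom b)
  dense_one_tmul : Dense (Submodule.span ℂ
    {x : MinTensor B A | ∃ (b : B) (a : A), x = toHom b * mtmul 1 a} : Set (MinTensor B A))

namespace Action

variable {A : Type u} [CStarAlgebra A] {G : CompactQuantumGroup A} {B : Type v} [CStarAlgebra B]

/-- A state `μ` of `B` is invariant if `(μ ⊗ id)(α b) = μ(b) 1` for all `b`. -/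
def IsInvariantState (α : Action G B) (μ : State B) : Prop :=
  ∀ b, slice μ (α.toHom b) = μ b • (1 : A)

/-- `π_I ⊗ id : B ⊗ A → (B / I) ⊗ A`. -/
def quotientTensor (A : Type u) [CStarAlgebra A] (I : Ideal B) [I.IsTwoSided]
    [IsClosed (I : Set B)] : MinTensor B A →⋆ₐ[ℂ] MinTensor (B ⧸ I) A :=
  MinTensor.map (quotientMap I) (StarAlgHom.id ℂ A)

/-- A closed two-sided ideal `I` is invariant if `(π_I ⊗ id)(α b) = 0` for all `b ∈ I`. -/
def IsInvariantIdeal (α : Action G B) (I : Ideal B) [I.IsTwoSided] [IsClosed (I : Set B)] : Prop :=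
  ∀ b ∈ I, quotientTensor A I (α.toHom b) = 0

/-- `β` is the action on `B / I` induced by `α`: `β(b + I) = (π_I ⊗ id)(α b)`. -/
def IsInduced (α : Action G B) (I : Ideal B) [I.IsTwoSided] [IsClosed (I : Set B)]
    (β : Action G (B ⧸ I)) : Prop :=
  ∀ b, β.toHom (quotientMap I b) = quotientTensor A I (α.toHom b)

end Action

namespace State

variable {B : Type v} [CStarAlgebra B]

/-- The kernel `I_μ` of the GNS representation of a state. -/
def gnsKernel (μ : State B) : Ideal B := RingHom.ker μ.gns

theorem mem_gnsKernel (μ : State B) (b : B) : b ∈ μ.gnsKernel ↔ μ.gns b = 0 := Iff.rfl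

instance (μ : State B) : μ.gnsKernel.IsTwoSided := inferInstanceAs (RingHom.ker μ.gns).IsTwoSided

instance (μ : State B) : IsClosed (μ.gnsKernel : Set B) := by
  have hc : Continuous μ.gns :=
    AddMonoidHomClass.continuous_of_bound μ.gns 1 fun b => by
      rw [one_mul]; exact NonUnitalStarAlgHom.norm_apply_le _ _
  exact isClosed_singleton.preimage hc

end State

end QuantumAction

end

/-!
Let `α` be an action of `(A, Δ)` on `B`, let `μ` be an invariant state with cyclic vector `ξ_μ`, let
`I` be its GNS kernel and `q : B → B / I` the quotient map. For a representation `ρ` of `A` on a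
Hilbert space `K` put `T = μ.gns ⊗ ρ`, a representation of `B ⊗ A`.

Invariance of `μ` says that the matrix coefficient of `T (α (b* b))` at `ξ_μ ⊗ η` is
`μ (b* b) ‖η‖ ^ 2`, so that `‖T (α b) (ξ_μ ⊗ η)‖ = ‖μ.gns b ξ_μ‖ ‖η‖`
(`Action.norm_tensorRep_cyclic`). Two facts follow.

* If `b ∈ I`, then `T (α b)` kills all vectors `T (α c (1 ⊗ a)) (ξ_μ ⊗ η)`, because
  `1 ⊗ a` only changes `η` and `b c ∈ I`. As `α(B)(1 ⊗ A)` is total in `B ⊗ A` and `ξ_μ` is cyclic,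
  `T (α b) = 0` (`Action.tensorRep_eq_zero`).
* If `T (α b) = 0` and `K ≠ 0`, then `μ.gns (b c) ξ_μ = 0` for all `c`, hence `b ∈ I`
  (`Action.gns_eq_zero_of_tensorRep`).

Since `μ.gns` is the composite of `q` with an injective representation `π` of `B / I`, one has
`T = (π ⊗ ρ) (q ⊗ id)`, and both facts can be read as statements about `(q ⊗ id) (α b)` as soon as
the representations `π ⊗ ρ` are known to separate the points of the minimal tensor product
`(B / I) ⊗ A` (`eq_zero_of_tensorRep`). That is seen with the slice maps `id ⊗ ω` for states `ω`
of `A`: they turn an element killed by all `π ⊗ ρ` into an element of `ker π = 0`.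

The first fact then says that `I` is invariant and the second that the induced map is injective.
That the induced map is an action is inherited from `α` by naturality of the associator
(`MinTensor.assoc_map`) and density of the range of `q ⊗ id` (`MinTensor.denseRange_map`).
-/

noncomputable section

namespace QuantumAction

universe u v

/-! ### Homomorphisms out of minimal tensor products -/

section MinTensorHom

variable {A B A' B' A'' B'' Z : Type*} [CStarAlgebra A] [CStarAlgebra B] [CStarAlgebra A']
  [CStarAlgebra B'] [CStarAlgebra A''] [CStarAlgebra B''] [CStarAlgebra Z]

theorem continuous_starAlgHom (F : A →⋆ₐ[ℂ] Z) : Continuous F :=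
  AddMonoidHomClass.continuous_of_bound F 1 fun a => by
    rw [one_mul]; exact NonUnitalStarAlgHom.norm_apply_le _ _

/-- A closed subspace containing the elementary tensors is everything. -/
theorem MinTensor.mem_of_mtmul (V : Submodule ℂ (MinTensor A B))
    (hV : IsClosed (V : Set (MinTensor A B))) (h : ∀ a b, mtmul a b ∈ V) (x : MinTensor A B) :
    x ∈ V := by
  refine incl_dense.induction_on (p := fun x => x ∈ (V : Set (MinTensor A B))) x hV fun z => ?_
  induction z with
  | zero => rw [map_zero]; exact V.zero_mem
  | add x y hx hy => rw [map_add]; exact V.add_mem hx hy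
  | tmul a b => exact h a b

theorem MinTensor.clm_ext {E : Type*} [NormedAddCommGroup E] [NormedSpace ℂ E]
    {F F' : MinTensor A B →L[ℂ] E} (h : ∀ a b, F (mtmul a b) = F' (mtmul a b))
    (x : MinTensor A B) : F x = F' x :=
  MinTensor.mem_of_mtmul (LinearMap.eqLocus F.toLinearMap F'.toLinearMap)
    (isClosed_eq F.continuous F'.continuous) h x

theorem MinTensor.hom_ext {F F' : MinTensor A B →⋆ₐ[ℂ] Z}
    (h : ∀ a b, F (mtmul a b) = F' (mtmul a b)) (x : MinTensor A B) : F x = F' x :=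
  MinTensor.mem_of_mtmul (LinearMap.eqLocus F.toAlgHom.toLinearMap F'.toAlgHom.toLinearMap)
    (isClosed_eq (continuous_starAlgHom F) (continuous_starAlgHom F')) h x

theorem MinTensor.map_map (f : A →⋆ₐ[ℂ] A') (g : B →⋆ₐ[ℂ] B') (f' : A' →⋆ₐ[ℂ] A'')
    (g' : B' →⋆ₐ[ℂ] B'') (x : MinTensor A B) :
    MinTensor.map f' g' (MinTensor.map f g x) = MinTensor.map (f'.comp f) (g'.comp g) x :=
  MinTensor.hom_ext (F := (MinTensor.map f' g').comp (MinTensor.map f g))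
    (fun a b => by simp) x

theorem tensorRep_mtmul {H K : Type*}
    [NormedAddCommGroup H] [InnerProductSpace ℂ H] [CompleteSpace H]
    [NormedAddCommGroup K] [InnerProductSpace ℂ K] [CompleteSpace K]
    (π : A →⋆ₐ[ℂ] (H →L[ℂ] H)) (ρ : B →⋆ₐ[ℂ] (K →L[ℂ] K)) (a : A) (b : B) :
    tensorRep π ρ (mtmul a b) = opTensor (π a) (ρ b) := by
  rw [mtmul, tensorRep_incl, algRep_tmul]

theorem tensorRep_map {H K : Type*}
    [NormedAddCommGroup H] [InnerProductSpace ℂ H] [CompleteSpace H]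
    [NormedAddCommGroup K] [InnerProductSpace ℂ K] [CompleteSpace K]
    (f : A →⋆ₐ[ℂ] A') (g : B →⋆ₐ[ℂ] B') (π : A' →⋆ₐ[ℂ] (H →L[ℂ] H))
    (ρ : B' →⋆ₐ[ℂ] (K →L[ℂ] K)) (x : MinTensor A B) :
    tensorRep π ρ (MinTensor.map f g x) = tensorRep (π.comp f) (ρ.comp g) x :=
  MinTensor.hom_ext (F := (tensorRep π ρ).comp (MinTensor.map f g))
    (fun a b => by simp [tensorRep_mtmul]) x

/-- Naturality of the associator in its first variable. -/
theorem MinTensor.assoc_map (f : A →⋆ₐ[ℂ] A') (C : Type*) [CStarAlgebra C]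
    (x : MinTensor (MinTensor A B) C) :
    MinTensor.assoc A' B C
        (MinTensor.map (MinTensor.map f (StarAlgHom.id ℂ B)) (StarAlgHom.id ℂ C) x) =
      MinTensor.map f (StarAlgHom.id ℂ (MinTensor B C)) (MinTensor.assoc A B C x) := by
  let F := (MinTensor.assoc A' B C).comp
    (MinTensor.map (MinTensor.map f (StarAlgHom.id ℂ B)) (StarAlgHom.id ℂ C))
  let F' := (MinTensor.map f (StarAlgHom.id ℂ (MinTensor B C))).comp (MinTensor.assoc A B C)
  refine inclLeft_dense.induction_on (p := fun x => F x = F' x) x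
    (isClosed_eq (continuous_starAlgHom F) (continuous_starAlgHom F')) fun z => ?_
  induction z with
  | zero => simp only [map_zero]
  | add x y hx hy => simp only [map_add, hx, hy]
  | tmul z c =>
    induction z with
    | zero => simp only [TensorProduct.zero_tmul, map_zero]
    | add x y hx hy => simp only [TensorProduct.add_tmul, map_add, hx, hy]
    | tmul a b => simp [F, F']

theorem MinTensor.denseRange_map {f : A →⋆ₐ[ℂ] A'} {g : B →⋆ₐ[ℂ] B'}
    (hf : Function.Surjective f) (hg : Function.Surjective g) :
    DenseRange (MinTensor.map f g) := by
  intro y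
  refine MinTensor.mem_of_mtmul
    (LinearMap.range (MinTensor.map f g).toAlgHom.toLinearMap).topologicalClosure
    (Submodule.isClosed_topologicalClosure _) (fun a b => ?_) y
  obtain ⟨a, rfl⟩ := hf a
  obtain ⟨b, rfl⟩ := hg b
  exact Submodule.le_topologicalClosure _ ⟨mtmul a b, MinTensor.map_mtmul f g a b⟩

end MinTensorHom

/-! ### Slice maps by states of the second factor -/

section RightSlice

variable {A B : Type*} [CStarAlgebra A] [CStarAlgebra B]
  {H K : Type*} [NormedAddCommGroup H] [InnerProductSpace ℂ H]
  [NormedAddCommGroup K] [InnerProductSpace ℂ K]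

/-- The operator `ξ ↦ ξ ⊗ η`. -/
def rightCreation (H : Type*) [NormedAddCommGroup H] [InnerProductSpace ℂ H] (η : K) :
    H →L[ℂ] HTensor H K :=
  LinearMap.mkContinuous
    { toFun := fun ξ => htmul ξ η
      map_add' := fun ξ ξ' => htmul_add_left ξ ξ' η
      map_smul' := fun c ξ => htmul_smul_left c ξ η }
    ‖η‖ (fun ξ => (norm_htmul ξ η).le.trans (mul_comm _ _).le)

@[simp] theorem rightCreation_apply (ξ : H) (η : K) : rightCreation H η ξ = htmul ξ η := rfl

theorem norm_rightCreation_le (η : K) : ‖rightCreation H η‖ ≤ ‖η‖ :=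
  LinearMap.mkContinuous_norm_le _ (norm_nonneg _) _

variable [CompleteSpace H]

theorem adjoint_rightCreation_htmul (ξ : H) (η ζ : K) :
    ContinuousLinearMap.adjoint (rightCreation H η) (htmul ξ ζ) = ⟪η, ζ⟫_ℂ • ξ := by
  refine ext_inner_left ℂ fun v => ?_
  rw [ContinuousLinearMap.adjoint_inner_right, rightCreation_apply, inner_htmul,
    inner_smul_right, mul_comm]

variable [CompleteSpace K]

/-- The slice map `id ⊙ f` on the algebraic tensor product. -/
def algRightSlice (f : B →ₗ[ℂ] ℂ) : A ⊗[ℂ] B →ₗ[ℂ] A :=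
  (TensorProduct.rid ℂ A).toLinearMap ∘ₗ TensorProduct.map LinearMap.id f

@[simp] theorem algRightSlice_tmul (f : B →ₗ[ℂ] ℂ) (a : A) (b : B) :
    algRightSlice f (a ⊗ₜ b) = f b • a := by
  simp [algRightSlice]

theorem rep_algRightSlice (π : A →⋆ₐ[ℂ] (H →L[ℂ] H)) (ρ : B →⋆ₐ[ℂ] (K →L[ℂ] K)) (η : K)
    (x : A ⊗[ℂ] B) : π (algRightSlice (vecFunctional ρ η) x) =
      (ContinuousLinearMap.adjoint (rightCreation H η)).comp
        ((algRep π ρ x).comp (rightCreation H η)) := by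
  induction x with
  | zero => simp
  | add x y hx hy =>
    simp only [map_add, hx, hy, ContinuousLinearMap.add_comp, ContinuousLinearMap.comp_add]
  | tmul a b =>
    ext ξ
    simp [vecFunctional, adjoint_rightCreation_htmul]

theorem norm_algRightSlice_le (ω : State B) (x : A ⊗[ℂ] B) :
    ‖algRightSlice ω.toLinearMap x‖ ≤ ‖incl A B x‖ := by
  refine norm_le_of_gns _ (norm_nonneg _) fun φ => ?_
  have h1 := norm_rightCreation_le (H := φ.GNSSpace) ω.cyclic
  rw [ω.norm_cyclic] at h1
  rw [← vecFunctional_cyclic, rep_algRightSlice]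
  calc _ ≤ ‖ContinuousLinearMap.adjoint (rightCreation φ.GNSSpace ω.cyclic)‖ *
        (‖algRep φ.gns ω.gns x‖ * ‖rightCreation φ.GNSSpace ω.cyclic‖) :=
        (ContinuousLinearMap.opNorm_comp_le _ _).trans
          (by gcongr; exact ContinuousLinearMap.opNorm_comp_le _ _)
    _ ≤ 1 * (‖incl A B x‖ * 1) := by
        rw [LinearIsometryEquiv.norm_map]
        gcongr
        exact norm_algRep_le _ _ x
    _ = _ := by ring

/-- The slice map `id ⊗ ω : A ⊗ B → A` of a state `ω` of `B`. -/
def rightSlice (ω : State B) : MinTensor A B →L[ℂ] A :=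
  LinearMap.extendOfNorm (algRightSlice ω.toLinearMap) (incl A B).toAlgHom.toLinearMap

theorem rightSlice_incl (ω : State B) (x : A ⊗[ℂ] B) :
    rightSlice ω (incl A B x) = algRightSlice ω.toLinearMap x := by
  have h : ∃ C, ∀ x, ‖algRightSlice (A := A) ω.toLinearMap x‖ ≤
      C * ‖(incl A B).toAlgHom.toLinearMap x‖ :=
    ⟨1, fun x => (norm_algRightSlice_le ω x).trans (one_mul _).ge⟩
  have hd : DenseRange (incl A B).toAlgHom.toLinearMap := incl_dense
  exact LinearMap.extendOfNorm_eq hd h x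

@[simp] theorem rightSlice_mtmul (ω : State B) (a : A) (b : B) :
    rightSlice ω (mtmul a b) = ω b • a := by
  simp [mtmul, rightSlice_incl]

/-- Matrix coefficients of `π ⊗ ω.gns` at the cyclic vector of `ω` factor through the right
slice. -/
theorem inner_tensorRep_gns_right (π : A →⋆ₐ[ℂ] (H →L[ℂ] H)) (ω : State B) (x : MinTensor A B)
    (ξ ξ' : H) : ⟪htmul ξ ω.cyclic, tensorRep π ω.gns x (htmul ξ' ω.cyclic)⟫_ℂ =
      ⟪ξ, π (rightSlice ω x) ξ'⟫_ℂ := by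
  let F : MinTensor A B →L[ℂ] ℂ := (innerSL ℂ (htmul ξ ω.cyclic)).comp
    ((ContinuousLinearMap.apply ℂ _ (htmul ξ' ω.cyclic)).comp
      ⟨(tensorRep π ω.gns).toAlgHom.toLinearMap, continuous_starAlgHom _⟩)
  let F' : MinTensor A B →L[ℂ] ℂ := (innerSL ℂ ξ).comp
    (((ContinuousLinearMap.apply ℂ _ ξ').comp
      ⟨π.toAlgHom.toLinearMap, continuous_starAlgHom _⟩).comp (rightSlice ω))
  refine MinTensor.clm_ext (F := F) (F' := F') (fun a b => ?_) x
  change ⟪htmul ξ ω.cyclic, tensorRep π ω.gns (mtmul a b) (htmul ξ' ω.cyclic)⟫_ℂ =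
      ⟪ξ, π (rightSlice ω (mtmul a b)) ξ'⟫_ℂ
  simp [tensorRep_mtmul, inner_htmul, ω.inner_cyclic, mul_comm]

/-- Matrix coefficients of `μ.gns ⊗ ρ` at the cyclic vector of `μ` factor through the slice map
`μ ⊗ id`. -/
theorem inner_tensorRep_gns_left (μ : State A) (ρ : B →⋆ₐ[ℂ] (K →L[ℂ] K)) (x : MinTensor A B)
    (η η' : K) : ⟪htmul μ.cyclic η, tensorRep μ.gns ρ x (htmul μ.cyclic η')⟫_ℂ =
      ⟪η, ρ (slice μ x) η'⟫_ℂ := by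
  let F : MinTensor A B →L[ℂ] ℂ := (innerSL ℂ (htmul μ.cyclic η)).comp
    ((ContinuousLinearMap.apply ℂ _ (htmul μ.cyclic η')).comp
      ⟨(tensorRep μ.gns ρ).toAlgHom.toLinearMap, continuous_starAlgHom _⟩)
  let F' : MinTensor A B →L[ℂ] ℂ := (innerSL ℂ η).comp
    (((ContinuousLinearMap.apply ℂ _ η').comp
      ⟨ρ.toAlgHom.toLinearMap, continuous_starAlgHom _⟩).comp (slice μ))
  refine MinTensor.clm_ext (F := F) (F' := F') (fun a b => ?_) x
  change ⟪htmul μ.cyclic η, tensorRep μ.gns ρ (mtmul a b) (htmul μ.cyclic η')⟫_ℂ =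
      ⟪η, ρ (slice μ (mtmul a b)) η'⟫_ℂ
  simp [tensorRep_mtmul, inner_htmul, μ.inner_cyclic]

end RightSlice

/-! ### Faithfulness of tensor products of representations -/

section Faithful

variable {A : Type*} {B : Type*} [CStarAlgebra A] [CStarAlgebra B]
  {H : Type*} [NormedAddCommGroup H] [InnerProductSpace ℂ H] [CompleteSpace H]

theorem State.dense_gns_cyclic (μ : State A) : DenseRange fun a => μ.gns a μ.cyclic := by
  let _ := CStarAlgebra.spectralOrder A
  let _ := CStarAlgebra.spectralOrderedRing A
  have h (a : A) : μ.gns a μ.cyclic =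
      ((μ.toPositive.toPreGNS a : μ.toPositive.PreGNS) : μ.toPositive.GNS) := by
    change μ.toPositive.gnsNonUnitalStarAlgHom a
      ((μ.toPositive.toPreGNS 1 : μ.toPositive.PreGNS) : μ.toPositive.GNS) = _
    rw [PositiveLinearMap.gnsNonUnitalStarAlgHom_apply_coe]
    simp
  simp only [h]
  exact (UniformSpace.Completion.denseRange_coe (α := μ.toPositive.PreGNS)).comp
    μ.toPositive.toPreGNS.surjective.denseRange (UniformSpace.Completion.continuous_coe _)

/-- The kernel of the GNS representation is detected on the cyclic vector by the right ideal
`a A`, since `A` moves the cyclic vector to a dense set. -/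
theorem State.gns_eq_zero (μ : State A) {a : A} (h : ∀ c, μ.gns (a * c) μ.cyclic = 0) :
    μ.gns a = 0 := by
  ext ζ
  refine μ.dense_gns_cyclic.induction_on (p := fun ζ => μ.gns a ζ = 0) ζ
    (isClosed_eq (by fun_prop) (by fun_prop)) fun c => ?_
  have := h c
  rwa [map_mul] at this

theorem eq_zero_of_tensorRep_gns {x : MinTensor A B}
    (h : ∀ (φ : State A) (ψ : State B), tensorRep φ.gns ψ.gns x = 0) : x = 0 :=
  norm_le_zero_iff.mp (norm_le_of_tensorRep x le_rfl fun φ ψ => by rw [h, norm_zero])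

/-- The matrix coefficient of `star x * x` at `φ.cyclic ⊗ ψ.cyclic` is the squared norm of the image
of that vector under `x`, and it factors through the right slice by `ψ`. -/
theorem gns_tensor_apply_cyclic {x : MinTensor A B} {φ : State A} {ψ : State B}
    (h : rightSlice ψ (star x * x) = 0) :
    tensorRep φ.gns ψ.gns x (htmul φ.cyclic ψ.cyclic) = 0 := by
  have h1 := inner_tensorRep_gns_right φ.gns ψ (star x * x) φ.cyclic φ.cyclic
  rw [inner_star_mul_self, h, map_zero, zero_apply, inner_zero_right] at h1
  simpa using h1

/-- If `π` is injective, the representations `π ⊗ ψ.gns` jointly separate the points of the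
minimal tensor product. -/
theorem eq_zero_of_tensorRep {π : A →⋆ₐ[ℂ] (H →L[ℂ] H)} (hπ : Function.Injective π)
    {x : MinTensor A B} (h : ∀ ψ : State B, tensorRep π ψ.gns x = 0) : x = 0 := by
  -- The elements killed by all `π ⊗ ψ.gns` form an ideal that `id ⊗ ψ` maps into `ker π = 0`;
  -- the factor `y` serves to move the cyclic vectors afterwards.
  have hs : ∀ (ψ : State B) (y : MinTensor A B), rightSlice ψ (star (x * y) * (x * y)) = 0 := by
    intro ψ y
    refine hπ ?_
    rw [map_zero]
    ext ξ'
    refine ext_inner_left ℂ fun ξ => ?_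
    rw [← inner_tensorRep_gns_right, map_mul, map_mul, h]
    simp
  refine eq_zero_of_tensorRep_gns fun φ ψ => ext_htmul fun ξ η => ?_
  have key : ∀ a b, tensorRep φ.gns ψ.gns x
      (htmul (φ.gns a φ.cyclic) (ψ.gns b ψ.cyclic)) = 0 := fun a b => by
    have := gns_tensor_apply_cyclic (φ := φ) (hs ψ (mtmul a b))
    rwa [map_mul, tensorRep_mtmul, mul_apply_eq_comp, opTensor_htmul] at this
  rw [zero_apply]
  refine φ.dense_gns_cyclic.induction_on (p := fun ξ => tensorRep φ.gns ψ.gns x (htmul ξ η) = 0) ξ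
    (isClosed_eq (((tensorRep φ.gns ψ.gns x).comp (rightCreation _ η)).continuous)
      continuous_const) fun a => ?_
  exact ψ.dense_gns_cyclic.induction_on
    (p := fun η => tensorRep φ.gns ψ.gns x (htmul (φ.gns a φ.cyclic) η) = 0) η
    (isClosed_eq (((tensorRep φ.gns ψ.gns x).comp (creation _ _)).continuous)
      continuous_const) fun b => key a b

end Faithful

/-! ### Homomorphisms out of quotients -/

section QuotientLift

variable {B : Type*} {Z : Type*} [CStarAlgebra B] [CStarAlgebra Z]
  (I : Ideal B) [I.IsTwoSided] [IsClosed (I : Set B)]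

/-- The `*`-homomorphism on `B / I` induced by a `*`-homomorphism vanishing on `I`. -/
def quotientLift (f : B →⋆ₐ[ℂ] Z) (hf : ∀ b ∈ I, f b = 0) : B ⧸ I →⋆ₐ[ℂ] Z :=
  { Ideal.Quotient.liftₐ I f.toAlgHom hf with
    map_star' := fun x => by
      obtain ⟨b, rfl⟩ := Ideal.Quotient.mk_surjective x
      exact map_star f b }

theorem quotientLift_comp (f : B →⋆ₐ[ℂ] Z) (hf : ∀ b ∈ I, f b = 0) :
    (quotientLift I f hf).comp (quotientMap I) = f := rfl

theorem quotientLift_injective (f : B →⋆ₐ[ℂ] Z) (hf : ∀ b, b ∈ I ↔ f b = 0) :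
    Function.Injective (quotientLift I f fun b => (hf b).mp) := by
  refine (injective_iff_map_eq_zero _).mpr fun x hx => ?_
  obtain ⟨b, rfl⟩ := Ideal.Quotient.mk_surjective x
  exact Ideal.Quotient.eq_zero_iff_mem.mpr ((hf b).mpr hx)

theorem quotientMap_surjective : Function.Surjective (quotientMap I) :=
  Ideal.Quotient.mk_surjective

end QuotientLift

/-! ### The GNS kernel of an invariant state -/

namespace Action

variable {A : Type u} [CStarAlgebra A] {G : CompactQuantumGroup A} {B : Type v} [CStarAlgebra B]
  {α : Action G B} {μ : State B}
  {K : Type*} [NormedAddCommGroup K] [InnerProductSpace ℂ K] [CompleteSpace K]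

/-- The identity through which invariance of `μ` enters: `α b` acts on `μ.cyclic ⊗ η` with the same
norm as `b ⊗ 1`. -/
theorem norm_tensorRep_cyclic (hμ : α.IsInvariantState μ) (ρ : A →⋆ₐ[ℂ] (K →L[ℂ] K)) (b : B)
    (η : K) : ‖tensorRep μ.gns ρ (α.toHom b) (htmul μ.cyclic η)‖ =
      ‖μ.gns b μ.cyclic‖ * ‖η‖ := by
  have h := inner_tensorRep_gns_left μ ρ (α.toHom (star b * b)) η η
  rw [hμ, ← μ.inner_cyclic, inner_star_mul_self, map_mul, map_star, inner_star_mul_self,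
    map_smul, map_one, smul_apply, one_apply_eq_self, inner_smul_right,
    inner_self_eq_norm_sq_to_K] at h
  refine (sq_eq_sq₀ (norm_nonneg _) (by positivity)).mp (Complex.ofReal_injective ?_)
  rw [h, mul_pow]
  simp

/-- If `b` lies in the GNS kernel of `μ`, then `α b` is killed by `μ.gns ⊗ ρ`. -/
theorem tensorRep_eq_zero (hμ : α.IsInvariantState μ) (ρ : A →⋆ₐ[ℂ] (K →L[ℂ] K)) {b : B}
    (hb : μ.gns b = 0) : tensorRep μ.gns ρ (α.toHom b) = 0 := by
  set T := tensorRep μ.gns ρ with hT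
  -- By density of `α(B)(1 ⊗ A)` it is enough to take `y = α(c)(1 ⊗ a)`, for which `T y` sends
  -- `μ.cyclic ⊗ η` to `T (α c) (μ.cyclic ⊗ ρ a η)`.
  have h1 : ∀ (y : MinTensor B A) (η : K), T (α.toHom b) (T y (htmul μ.cyclic η)) = 0 := by
    intro y η
    let F : MinTensor B A →L[ℂ] HTensor μ.GNSSpace K := (T (α.toHom b)).comp
      ((ContinuousLinearMap.apply ℂ _ (htmul μ.cyclic η)).comp
        ⟨T.toAlgHom.toLinearMap, continuous_starAlgHom _⟩)
    have hF : F = 0 := by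
      refine ContinuousLinearMap.ext_on α.dense_one_tmul ?_
      rintro _ ⟨c, a, rfl⟩
      change T (α.toHom b) (T (α.toHom c * mtmul 1 a) (htmul μ.cyclic η)) = 0
      have e : T (mtmul 1 a) (htmul μ.cyclic η) = htmul μ.cyclic (ρ a η) := by
        rw [hT, tensorRep_mtmul, opTensor_htmul, map_one, one_apply_eq_self]
      rw [map_mul, mul_apply_eq_comp, e, ← mul_apply_eq_comp, ← map_mul, ← map_mul,
        ← norm_eq_zero, norm_tensorRep_cyclic hμ, map_mul, hb]
      simp
    exact congrArg (fun F => F y) hF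
  refine ext_htmul fun ξ η => ?_
  rw [zero_apply]
  refine μ.dense_gns_cyclic.induction_on (p := fun ξ => T (α.toHom b) (htmul ξ η) = 0) ξ
    (isClosed_eq ((T (α.toHom b)).comp (rightCreation _ η)).continuous
      continuous_const) fun c => ?_
  -- For `y = c ⊗ 1` the vector `T y (μ.cyclic ⊗ η)` is `(μ.gns c μ.cyclic) ⊗ η`.
  have := h1 (mtmul c 1) η
  rwa [hT, tensorRep_mtmul, opTensor_htmul, map_one, one_apply_eq_self] at this

/-- Converse of `tensorRep_eq_zero`; the space of `ρ` must be nonzero. -/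
theorem gns_eq_zero_of_tensorRep [Nontrivial K] (hμ : α.IsInvariantState μ)
    (ρ : A →⋆ₐ[ℂ] (K →L[ℂ] K)) {b : B} (hb : tensorRep μ.gns ρ (α.toHom b) = 0) :
    μ.gns b = 0 := by
  obtain ⟨η, hη⟩ := exists_ne (0 : K)
  refine μ.gns_eq_zero fun c => ?_
  have h := norm_tensorRep_cyclic hμ ρ (b * c) η
  rw [map_mul, map_mul, hb, zero_mul, zero_apply, norm_zero, eq_comm, mul_eq_zero] at h
  exact norm_eq_zero.mp (h.resolve_right (norm_ne_zero_iff.mpr hη))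

theorem isInvariantIdeal_gnsKernel (hμ : α.IsInvariantState μ) :
    α.IsInvariantIdeal μ.gnsKernel := by
  intro b hb
  refine eq_zero_of_tensorRep
    (quotientLift_injective μ.gnsKernel μ.gns μ.mem_gnsKernel) fun ψ => ?_
  rw [quotientTensor, tensorRep_map, quotientLift_comp]
  exact tensorRep_eq_zero hμ _ hb

/-- The action on `B / I` induced by an action on `B` that leaves `I` invariant. -/
def induced (α : Action G B) (I : Ideal B) [I.IsTwoSided] [IsClosed (I : Set B)]
    (hI : α.IsInvariantIdeal I) : Action G (B ⧸ I) where
  toHom := quotientLift I ((quotientTensor A I).comp α.toHom)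
    fun b hb => (StarAlgHom.comp_apply _ _ b).trans (hI b hb)
  coassoc x := by
    obtain ⟨b, rfl⟩ := quotientMap_surjective I x
    change MinTensor.assoc (B ⧸ I) A A (MinTensor.map _ (StarAlgHom.id ℂ A)
      (MinTensor.map (quotientMap I) (StarAlgHom.id ℂ A) (α.toHom b))) =
      MinTensor.map (StarAlgHom.id ℂ (B ⧸ I)) G.comul
        (MinTensor.map (quotientMap I) (StarAlgHom.id ℂ A) (α.toHom b))
    rw [MinTensor.map_map, quotientLift_comp, StarAlgHom.comp_id, quotientTensor]
    have h1 : MinTensor.map ((MinTensor.map (quotientMap I) (StarAlgHom.id ℂ A)).comp α.toHom)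
        (StarAlgHom.id ℂ A) (α.toHom b) =
        MinTensor.map (MinTensor.map (quotientMap I) (StarAlgHom.id ℂ A)) (StarAlgHom.id ℂ A)
          (MinTensor.map α.toHom (StarAlgHom.id ℂ A) (α.toHom b)) := by
      rw [MinTensor.map_map, StarAlgHom.comp_id]
    rw [h1, MinTensor.assoc_map, α.coassoc, MinTensor.map_map, MinTensor.map_map]
    rfl
  dense_one_tmul := by
    -- `q ⊗ id` has dense range and maps `α(b)(1 ⊗ a)` to `α_I(q b)(1 ⊗ a)`.
    have hd := (MinTensor.denseRange_map (quotientMap_surjective I)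
      (g := StarAlgHom.id ℂ A) Function.surjective_id).dense_image
      (continuous_starAlgHom _) α.dense_one_tmul
    refine hd.mono ?_
    rintro _ ⟨y, hy, rfl⟩
    refine Submodule.span_induction (p := fun y _ =>
      MinTensor.map (quotientMap I) (StarAlgHom.id ℂ A) y ∈ Submodule.span ℂ _)
      ?_ ?_ ?_ ?_ hy
    · rintro _ ⟨b, a, rfl⟩
      refine Submodule.subset_span ⟨quotientMap I b, a, ?_⟩
      rw [map_mul, MinTensor.map_mtmul, map_one]
      rfl
    · rw [map_zero]
      exact Submodule.zero_mem _
    · intro x y _ _ hx hy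
      rw [map_add]
      exact Submodule.add_mem _ hx hy
    · intro c x _ hx
      rw [map_smul]
      exact Submodule.smul_mem _ c hx

theorem induced_injective [Nontrivial A] (hμ : α.IsInvariantState μ) :
    Function.Injective (α.induced μ.gnsKernel (isInvariantIdeal_gnsKernel hμ)).toHom := by
  refine (injective_iff_map_eq_zero _).mpr fun x hx => ?_
  obtain ⟨b, rfl⟩ := quotientMap_surjective μ.gnsKernel x
  -- Any state `ω` of `A` provides a representation on a nonzero space.
  obtain ⟨ω, -⟩ := exists_state_norm (1 : A)
  refine Ideal.Quotient.eq_zero_iff_mem.mpr (gns_eq_zero_of_tensorRep hμ ω.gns ?_)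
  have h : quotientTensor A μ.gnsKernel (α.toHom b) = 0 := hx
  -- Now `μ.gns ⊗ ω.gns` factors through `q ⊗ id`, as `μ.gns` factors through `q`.
  rw [← quotientLift_comp μ.gnsKernel μ.gns fun b => (μ.mem_gnsKernel b).mp,
    ← StarAlgHom.comp_id ω.gns, ← tensorRep_map]
  exact (congrArg _ h).trans (map_zero _)

end Action

end QuantumAction

end

theorem mainTheorem4 {A : Type*} [CStarAlgebra A] [Nontrivial A]
    (G : QuantumAction.CompactQuantumGroup A) {B : Type*} [CStarAlgebra B]
    (α : QuantumAction.Action G B) (μ : QuantumAction.State B) (hμ : α.IsInvariantState μ) :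
    α.IsInvariantIdeal μ.gnsKernel ∧
      ∃ αμ : QuantumAction.Action G (B ⧸ μ.gnsKernel),
        α.IsInduced μ.gnsKernel αμ ∧ Function.Injective αμ.toHom :=
  ⟨QuantumAction.Action.isInvariantIdeal_gnsKernel hμ,
    α.induced μ.gnsKernel (QuantumAction.Action.isInvariantIdeal_gnsKernel hμ),
    fun _ => rfl, QuantumAction.Action.induced_injective hμ⟩
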